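/- Let $\mathbb F$ be a field and let $[0,\infty]^2=[0,\infty]\times[0,\infty]$ carry the product order, regarded as a category. Write $\mathsf{Vec}_{\mathbb F}$ for the category of $\mathbb F$-vector spaces. A functor $F\colon[0,\infty]^2\to\mathsf{Vec}_{\mathbb F}$ is *p.f.d.* if every $F(x)$ is finite-dimensional. It is *codegree 1* (resp. *degree 1*) if it sends every square in $[0,\infty]^2$ that is both a pullback and a pushout square to a pushout (resp. pullback) square of vector spaces; that is, if it takes strongly bicartesian 2-cubes to cocartesian (resp. cartesian) 2-cubes. An *interval* in a poset $P$ is a nonempty subset $I\subseteq P$ such that $x\le z\le y$ with $x,y\in I$ implies $z\in I$, and such that any two points of $I$ are connected by a zigzag of order relations within $I$. The *interval module* $\mathbb F_I$ is the functor $P\to\mathsf{Vec}_{\mathbb F}$ with $\mathbb F_I(x)=\mathbb F$ for $x\in I$ and $\mathbb F_I(x)=0$ for $x\notin I$, whose structure map for $x\le y$ is the identity if $x,y\in I$ and zero otherwise. An interval $I\subseteq[0,\infty]^2$ is - a *death block* if $I=J_1\times J_2$ with $J_1,J_2\subseteq[0,\infty]$ down-closed; - a *birth block* if $I=J_1\times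 J_2$ with $J_1,J_2\subseteq[0,\infty]$ up-closed; - a *vertical block* if $I=J\times[0,\infty]$ for an interval $J\subseteq[0,\infty]$; - a *horizontal block* if $I=[0,\infty]\times J$ for an interval $J\subseteq[0,\infty]$. **Proposition.** Let $F\colon[0,\infty]^2\to\mathsf{Vec}_{\mathbb F}$ be a p.f.d. functor. 1. If $F$ is codegree 1, then $F$ is isomorphic to a direct sum of interval modules (repetitions allowed), each over a death block, a vertical block or a horizontal block. 2. Dually, if $F$ is degree 1, then $F$ is isomorphic to a direct sum of interval modules (repetitions allowed), each over a birth block, a vertical block or a horizontal block. -/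

import Mathlib

open CategoryTheory CategoryTheory.Limits
open scoped ENNReal

universe u v w

/-! ### Cubical diagrams -/

/-- A `k`-cube in `C`: a functor from the power set of a `k`-element set, ordered by inclusion. -/
abbrev Cube (k : ℕ) (C : Type u) [Category.{v} C] := Finset (Fin k) ⥤ C

namespace Cube

variable {k : ℕ} {C : Type u} [Category.{v} C]

/-- For `S ⊆ T`, the face of `X` on `{U | S ⊆ U ⊆ T}` (a cube of dimension `#(T \ S)`), with its
terminal vertex removed. -/
@[simps]
def lowerFace (X : Cube k C) (S T : Finset (Fin k)) :
    {U : Finset (Fin k) // S ≤ U ∧ U < T} ⥤ C where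
  obj U := X.obj U.1
  map f := X.map (homOfLE (leOfHom f))
  map_id _ := X.map_id _
  map_comp _ _ := X.map_comp _ _

/-- For `S ⊆ T`, the face of `X` on `{U | S ⊆ U ⊆ T}`, with its initial vertex removed. -/
@[simps]
def upperFace (X : Cube k C) (S T : Finset (Fin k)) :
    {U : Finset (Fin k) // S < U ∧ U ≤ T} ⥤ C where
  obj U := X.obj U.1
  map f := X.map (homOfLE (leOfHom f))
  map_id _ := X.map_id _
  map_comp _ _ := X.map_comp _ _

/-- The canonical cocone on the face from `S` to `T` with its terminal vertex `X(T)` as point. -/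
@[simps]
def faceCocone (X : Cube k C) (S T : Finset (Fin k)) : Cocone (X.lowerFace S T) where
  pt := X.obj T
  ι :=
    { app := fun U => X.map (homOfLE U.2.2.le)
      naturality := fun U V f => by
        exact (X.map_comp _ _).symm.trans (Category.comp_id _).symm }

/-- The canonical cone on the face from `S` to `T` with its initial vertex `X(S)` as point. -/
@[simps]
def faceCone (X : Cube k C) (S T : Finset (Fin k)) : Cone (X.upperFace S T) where
  pt := X.obj S
  π :=
    { app := fun U => X.map (homOfLE U.2.1.le)
      naturality := fun U V f => by
        exact (Category.id_comp _).trans (X.map_comp _ _) }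

/-- The face of `X` from `S` to `T` is cocartesian: `colim_{S ⊆ U ⊊ T} X(U) → X(T)` is an
isomorphism. -/
def IsCocartesianFace (X : Cube k C) (S T : Finset (Fin k)) : Prop :=
  Nonempty (IsColimit (X.faceCocone S T))

/-- The face of `X` from `S` to `T` is cartesian: `X(S) → lim_{S ⊊ U ⊆ T} X(U)` is an
isomorphism. -/
def IsCartesianFace (X : Cube k C) (S T : Finset (Fin k)) : Prop :=
  Nonempty (IsLimit (X.faceCone S T))

/-- `X` is cocartesian: the canonical map `colim_{U ≠ univ} X(U) → X(univ)` is an isomorphism. -/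
def IsCocartesian (X : Cube k C) : Prop := X.IsCocartesianFace ∅ Finset.univ

/-- `X` is cartesian: the canonical map `X(∅) → lim_{U ≠ ∅} X(U)` is an isomorphism. -/
def IsCartesian (X : Cube k C) : Prop := X.IsCartesianFace ∅ Finset.univ

/-- Every face of dimension at least two is both cartesian and cocartesian. -/
def IsStronglyBicartesian (X : Cube k C) : Prop :=
  ∀ S T : Finset (Fin k), S ⊆ T → 2 ≤ (T \ S).card →
    X.IsCartesianFace S T ∧ X.IsCocartesianFace S T

end Cube

/-! ### Degree and codegree of functors on a distributive lattice -/

/-- `F` takes strongly bicartesian `(n+1)`-cubes in the lattice `P` (seen as a category) to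
cocartesian `(n+1)`-cubes. -/
def IsCodegree {P : Type w} [DistribLattice P] {C : Type u} [Category.{v} C] (n : ℕ)
    (F : P ⥤ C) : Prop :=
  ∀ X : Cube (n + 1) P, X.IsStronglyBicartesian → Cube.IsCocartesian (X ⋙ F)

/-- `F` takes strongly bicartesian `(n+1)`-cubes in the lattice `P` (seen as a category) to
cartesian `(n+1)`-cubes. -/
def IsDegree {P : Type w} [DistribLattice P] {C : Type u} [Category.{v} C] (n : ℕ)
    (F : P ⥤ C) : Prop :=
  ∀ X : Cube (n + 1) P, X.IsStronglyBicartesian → Cube.IsCartesian (X ⋙ F)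

/-! ### Persistence modules -/

/-- Functors from the poset `P` to vector spaces over `𝕜`. (The category structure on `P` is the
one given by its order, also when `P` is a product.) -/
abbrev PersistenceModule (𝕜 : Type u) [Field 𝕜] (P : Type w) [PartialOrder P] :=
  P ⥤ ModuleCat.{u} 𝕜

/-- Pointwise finite-dimensional. -/
def PersistenceModule.IsPFD {𝕜 : Type u} [Field 𝕜] {P : Type w} [PartialOrder P]
    (F : PersistenceModule 𝕜 P) : Prop :=
  ∀ x : P, FiniteDimensional 𝕜 (F.obj x)

/-- An interval in a poset: a nonempty convex subset, any two points of which are joined by a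
zigzag of order relations inside the subset. -/
structure IsPosetInterval {P : Type w} [PartialOrder P] (I : Set P) : Prop where
  nonempty : I.Nonempty
  convex : ∀ ⦃x y z : P⦄, x ∈ I → y ∈ I → x ≤ z → z ≤ y → z ∈ I
  connected : ∀ ⦃x y : P⦄, x ∈ I → y ∈ I →
    Relation.ReflTransGen (fun a b => a ∈ I ∧ b ∈ I ∧ (a ≤ b ∨ b ≤ a)) x y

section IntervalModule

variable (𝕜 : Type u) [Field 𝕜] {P : Type w} [PartialOrder P]

open Classical in
/-- The value at `x` of the interval module over `I`: all of `𝕜` if `x ∈ I`, and zero otherwise. -/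
noncomputable def intervalStalk (I : Set P) (x : P) : Submodule 𝕜 𝕜 :=
  if x ∈ I then ⊤ else ⊥

open Classical in
/-- The structure map of the interval module: the identity of `𝕜` if `x, y ∈ I`, and zero
otherwise. -/
noncomputable def intervalMap (I : Set P) (x y : P) :
    intervalStalk 𝕜 I x →ₗ[𝕜] intervalStalk 𝕜 I y :=
  if h : x ∈ I ∧ y ∈ I then
    Submodule.inclusion (by simp [intervalStalk, h.1, h.2])
  else 0

/-- The interval module over an interval `I`. -/
noncomputable def intervalModule (I : Set P) (hI : IsPosetInterval I) : PersistenceModule 𝕜 P where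
  obj x := ModuleCat.of 𝕜 (intervalStalk 𝕜 I x)
  map {x y} _ := ModuleCat.ofHom (intervalMap 𝕜 I x y)
  map_id x := by
    ext c
    by_cases hx : x ∈ I
    · simp [intervalMap, hx]
    · have : (c : 𝕜) = 0 := by
        have := c.2
        simpa [intervalStalk, hx] using this
      simp [intervalMap, hx, this]
  map_comp {x y z} f g := by
    ext c
    by_cases hx : x ∈ I <;> by_cases hz : z ∈ I
    · have hy : y ∈ I := hI.convex hx hz (leOfHom f) (leOfHom g)
      simp [intervalMap, hx, hy, hz]
    all_goals simp [intervalMap, hx, hz]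

end IntervalModule

/-- `F` is isomorphic to a direct sum of interval modules over intervals satisfying `B` (with
repetitions allowed). The direct sum is the coproduct in the category of persistence modules. -/
def PersistenceModule.IsIntervalDecomposableOver {𝕜 : Type u} [Field 𝕜] {P : Type w}
    [PartialOrder P] (F : PersistenceModule 𝕜 P) (B : Set P → Prop) : Prop :=
  ∃ (ι : Type w) (I : ι → Set P) (hI : ∀ i, IsPosetInterval (I i))
    (c : Cofan fun i => intervalModule 𝕜 (I i) (hI i)),
    (∀ i, B (I i)) ∧ Nonempty (IsColimit c) ∧ Nonempty (F ≅ c.pt)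

/-! ### Blocks in `[0,∞]²` -/

/-- A product of two down-closed subsets of `[0,∞]`. -/
def IsDeathBlock (I : Set (ℝ≥0∞ × ℝ≥0∞)) : Prop :=
  IsPosetInterval I ∧ ∃ J₁ J₂ : Set ℝ≥0∞, IsLowerSet J₁ ∧ IsLowerSet J₂ ∧ I = J₁ ×ˢ J₂

/-- A product of two up-closed subsets of `[0,∞]`. -/
def IsBirthBlock (I : Set (ℝ≥0∞ × ℝ≥0∞)) : Prop :=
  IsPosetInterval I ∧ ∃ J₁ J₂ : Set ℝ≥0∞, IsUpperSet J₁ ∧ IsUpperSet J₂ ∧ I = J₁ ×ˢ J₂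

/-- `J × [0,∞]` for an interval `J`. -/
def IsVerticalBlock (I : Set (ℝ≥0∞ × ℝ≥0∞)) : Prop :=
  IsPosetInterval I ∧ ∃ J : Set ℝ≥0∞, IsPosetInterval J ∧ I = J ×ˢ Set.univ

/-- `[0,∞] × J` for an interval `J`. -/
def IsHorizontalBlock (I : Set (ℝ≥0∞ × ℝ≥0∞)) : Prop :=
  IsPosetInterval I ∧ ∃ J : Set ℝ≥0∞, IsPosetInterval J ∧ I = Set.univ ×ˢ J

/-!
Every nonzero p.f.d. module of the given kind has an interval summand. A maximal family of pairwise
orthogonal interval summands is locally finite by finite dimensionality, so its sum is split off by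
an idempotent; the complement is again of the given kind, hence zero by maximality.

Suppose `M` is of degree 1. If `M(⊤) ≠ 0`, the images in `M(⊤)` of the structure maps along the two
edges through `⊤` form two chains of subspaces, and a vector and a functional adapted to both chains
split off a birth block. If `M(⊤) = 0`, the cartesian squares with corner `⊤` identify `M` with the
sum of its restrictions to the two edges, pulled back along the projections, and an interval summand
over the linear order of an edge extends to a strip. The codegree 1 case follows by pointwise
duality.
-/

section LinearAlgebra

theorem exists_ne_zero_mem_or_eq_bot_of_isChain {R V : Type*} [Ring R] [AddCommGroup V] [Module R V]
    [IsArtinian R V] [Nontrivial V] {A : Set (Submodule R V)} (hA : IsChain (· ≤ ·) A) :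
    ∃ e : V, e ≠ 0 ∧ ∀ K ∈ A, e ∈ K ∨ K = ⊥ := by
  have hne : {K | K ∈ insert ⊤ A ∧ K ≠ ⊥}.Nonempty := ⟨⊤, Or.inl rfl, top_ne_bot⟩
  obtain ⟨K₀, ⟨hK₀, hK₀_ne⟩, hmin⟩ := wellFounded_lt.has_min _ hne
  obtain ⟨e, heK₀, he⟩ := Submodule.exists_mem_ne_zero_of_ne_bot hK₀_ne
  have hchain : IsChain (· ≤ ·) (insert ⊤ A) := hA.insert fun _ _ _ => Or.inr le_top
  refine ⟨e, he, fun K hK => or_iff_not_imp_right.2 fun hK_ne => ?_⟩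
  have hK₀K : K₀ ≤ K := (hchain.total hK₀ (Or.inr hK)).elim id fun h =>
    (h.eq_or_lt.resolve_right (hmin K ⟨Or.inr hK, hK_ne⟩)).ge
  exact hK₀K heK₀

theorem exists_dual_eq_one_mem_or_le_ker_of_isChain {𝕜 V : Type*} [Field 𝕜] [AddCommGroup V]
    [Module 𝕜 V] {B : Set (Submodule 𝕜 V)} (hB : IsChain (· ≤ ·) B) {e : V} (he : e ≠ 0) :
    ∃ φ : Module.Dual 𝕜 V, φ e = 1 ∧ ∀ K ∈ B, e ∈ K ∨ K ≤ LinearMap.ker φ := by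
  let A : Set (Submodule 𝕜 V) := insert ⊥ {K ∈ B | e ∉ K}
  have hA : IsChain (· ≤ ·) A := (hB.mono (Set.sep_subset _ _)).insert fun _ _ _ => Or.inl bot_le
  have heA : e ∉ sSup A := by
    rw [Submodule.mem_sSup_of_directed ⟨⊥, Or.inl rfl⟩ hA.directedOn]
    rintro ⟨K, rfl | ⟨-, hK⟩, heK⟩
    exacts [he heK, hK heK]
  obtain ⟨ψ, hψ, hAψ⟩ := Submodule.exists_le_ker_of_notMem heA
  refine ⟨(ψ e)⁻¹ • ψ, inv_mul_cancel₀ hψ, fun K hK => or_iff_not_imp_left.2 fun heK v hv => ?_⟩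
  have hKA : K ∈ A := Or.inr ⟨hK, heK⟩
  have hψv : ψ v = 0 := hAψ (le_sSup hKA hv)
  simp [hψv]

/-- A vector `e` and a functional `φ` with `φ e = 1` are adapted to a family of subspaces if each
member either contains `e` or is killed by `φ`, so that the splitting `V = 𝕜 e ⊕ ker φ` restricts
to each member. -/
structure IsAdaptedPair {𝕜 V : Type*} [Field 𝕜] [AddCommGroup V] [Module 𝕜 V] (e : V)
    (φ : Module.Dual 𝕜 V) (A : Set (Submodule 𝕜 V)) : Prop where
  apply_eq_one : φ e = 1
  mem_or_le_ker : ∀ K ∈ A, e ∈ K ∨ K ≤ LinearMap.ker φ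

theorem IsAdaptedPair.mono {𝕜 V : Type*} [Field 𝕜] [AddCommGroup V] [Module 𝕜 V] {e : V}
    {φ : Module.Dual 𝕜 V} {A B : Set (Submodule 𝕜 V)} (h : IsAdaptedPair e φ B) (hAB : A ⊆ B) :
    IsAdaptedPair e φ A :=
  ⟨h.apply_eq_one, fun K hK => h.mem_or_le_ker K (hAB hK)⟩

theorem exists_isAdaptedPair_union_of_isChain {𝕜 V : Type*} [Field 𝕜] [AddCommGroup V] [Module 𝕜 V]
    [FiniteDimensional 𝕜 V] [Nontrivial V] {A B : Set (Submodule 𝕜 V)}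
    (hA : IsChain (· ≤ ·) A) (hB : IsChain (· ≤ ·) B) :
    ∃ (e : V) (φ : Module.Dual 𝕜 V), IsAdaptedPair e φ (A ∪ B) := by
  obtain ⟨e, he, heA⟩ := exists_ne_zero_mem_or_eq_bot_of_isChain hA
  obtain ⟨φ, hφe, hφB⟩ := exists_dual_eq_one_mem_or_le_ker_of_isChain hB he
  refine ⟨e, φ, hφe, fun K hK => hK.elim (fun hKA => ?_) (hφB K)⟩
  exact (heA K hKA).imp_right fun hK_bot => hK_bot.trans_le bot_le

theorem exists_comp_eq_of_ker_le_ker {𝕜 V W : Type*} [Field 𝕜] [AddCommGroup V] [Module 𝕜 V]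
    [AddCommGroup W] [Module 𝕜 W] {f : V →ₗ[𝕜] W} {φ : Module.Dual 𝕜 V}
    (h : LinearMap.ker f ≤ LinearMap.ker φ) : ∃ ψ : Module.Dual 𝕜 W, ψ ∘ₗ f = φ := by
  have hφ : φ ∈ LinearMap.range f.dualMap := by
    rw [LinearMap.range_dualMap_eq_dualAnnihilator_ker, Submodule.mem_dualAnnihilator]
    exact fun v hv => h hv
  exact hφ

theorem ker_dualMap_le_ker_eval_iff {𝕜 V W : Type*} [Field 𝕜] [AddCommGroup V] [Module 𝕜 V]
    [AddCommGroup W] [Module 𝕜 W] {f : V →ₗ[𝕜] W} {w : W} :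
    LinearMap.ker f.dualMap ≤ LinearMap.ker (Module.Dual.eval 𝕜 W w) ↔ w ∈ LinearMap.range f := by
  rw [LinearMap.ker_dualMap_eq_dualAnnihilator_range]
  exact Subspace.forall_mem_dualAnnihilator_apply_eq_zero_iff _ _

end LinearAlgebra

namespace PersistenceModule

variable {𝕜 : Type u} [Field 𝕜] {P Q : Type w} [PartialOrder P] [PartialOrder Q]

section Basic

/-- The value of a persistence module at a point. Going through a general poset `P` keeps the
order category structure when `P` is a product, where `M.obj x` would be elaborated with the
product category structure. -/
abbrev stalk (M : PersistenceModule 𝕜 P) (x : P) : ModuleCat.{u} 𝕜 :=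
  M.obj x

/-- The structure map of a persistence module along `x ≤ y`, as a linear map. -/
def tr (M : PersistenceModule 𝕜 P) {x y : P} (h : x ≤ y) : M.stalk x →ₗ[𝕜] M.stalk y :=
  (M.map (homOfLE h)).hom

/-- The component at a point of a morphism of persistence modules, as a linear map. -/
def appLin {M N : PersistenceModule 𝕜 P} (η : M ⟶ N) (x : P) : M.stalk x →ₗ[𝕜] N.stalk x :=
  (η.app x).hom

variable (M : PersistenceModule 𝕜 P) {N : PersistenceModule 𝕜 P}

@[simp]
theorem tr_refl {x : P} (h : x ≤ x) (v : M.stalk x) : M.tr h v = v := by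
  simp [tr]

@[simp]
theorem tr_tr {x y z : P} (h : x ≤ y) (h' : y ≤ z) (v : M.stalk x) :
    M.tr h' (M.tr h v) = M.tr (h.trans h') v :=
  congrArg (fun g => g.hom v) (M.map_comp (homOfLE h) (homOfLE h')).symm

variable {M} in
theorem appLin_tr (η : M ⟶ N) {x y : P} (h : x ≤ y) (v : M.stalk x) :
    appLin η y (M.tr h v) = N.tr h (appLin η x v) :=
  congrArg (fun g => g.hom v) (η.naturality (homOfLE h))

theorem appLin_r_appLin_i (ρ : Retract M N) (x : P) (v : M.stalk x) :
    appLin ρ.r x (appLin ρ.i x v) = v :=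
  congrArg (fun η => appLin η x v) ρ.retract

theorem ker_tr_le_ker_tr {x y z : P} (hxy : x ≤ y) (hyz : y ≤ z) :
    LinearMap.ker (M.tr hxy) ≤ LinearMap.ker (M.tr (hxy.trans hyz)) := fun v hv => by
  rw [LinearMap.mem_ker, ← M.tr_tr hxy hyz, LinearMap.mem_ker.1 hv, map_zero]

theorem range_tr_le_range_tr {x y z : P} (hxy : x ≤ y) (hyz : y ≤ z) :
    LinearMap.range (M.tr (hxy.trans hyz)) ≤ LinearMap.range (M.tr hyz) := by
  rintro _ ⟨v, rfl⟩
  exact ⟨M.tr hxy v, M.tr_tr hxy hyz v⟩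

/-- The restriction of a persistence module along a monotone map. -/
abbrev comap (f : Q →o P) : PersistenceModule 𝕜 Q where
  obj x := M.stalk (f x)
  map h := M.map (homOfLE (f.monotone (leOfHom h)))
  map_id _ := M.map_id _
  map_comp _ _ := M.map_comp _ _

/-- The restriction of a persistence module to a subset of the indexing poset. -/
abbrev restrict (U : Set P) : PersistenceModule 𝕜 U :=
  M.comap ⟨Subtype.val, Subtype.mono_coe U⟩

@[simp]
theorem comap_tr (f : Q →o P) {x y : Q} (h : x ≤ y) : (M.comap f).tr h = M.tr (f.monotone h) :=
  rfl

/-- The pointwise dual of a persistence module, over the opposite poset. -/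
abbrev dual : PersistenceModule 𝕜 Pᵒᵈ where
  obj x := ModuleCat.of 𝕜 (Module.Dual 𝕜 (M.stalk (OrderDual.ofDual x)))
  map f := ModuleCat.ofHom (M.tr (OrderDual.ofDual_le_ofDual.2 (leOfHom f))).dualMap
  map_id _ := ModuleCat.hom_ext <| LinearMap.ext fun φ : Module.Dual 𝕜 _ =>
    LinearMap.ext fun v => congrArg φ (M.tr_refl le_rfl v)
  map_comp _ _ := ModuleCat.hom_ext <| LinearMap.ext fun φ : Module.Dual 𝕜 _ =>
    LinearMap.ext fun v => (congrArg φ (M.tr_tr _ _ v)).symm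

variable {M}

theorem IsPFD.comap (hM : M.IsPFD) (f : Q →o P) : (M.comap f).IsPFD :=
  fun x => hM (f x)

theorem IsPFD.dual (hM : M.IsPFD) : M.dual.IsPFD := fun x =>
  have := hM (OrderDual.ofDual x)
  inferInstanceAs (FiniteDimensional 𝕜 (Module.Dual 𝕜 (M.stalk (OrderDual.ofDual x))))

theorem IsPFD.of_retract (ρ : Retract M N) (hN : N.IsPFD) : M.IsPFD := fun x =>
  have := hN x
  FiniteDimensional.of_injective (appLin ρ.i x)
    (Function.LeftInverse.injective (M.appLin_r_appLin_i ρ x))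

/-- The transpose of a morphism of persistence modules. -/
def dualMap (η : M ⟶ N) : N.dual ⟶ M.dual where
  app x := ModuleCat.ofHom (appLin η (OrderDual.ofDual x)).dualMap
  naturality _ _ _ := ModuleCat.hom_ext <| LinearMap.ext fun φ : Module.Dual 𝕜 _ =>
    LinearMap.ext fun v => (congrArg φ (appLin_tr η _ v)).symm

/-- Restriction along a monotone map preserves retracts. -/
def retractComap (ρ : Retract M N) (f : Q →o P) :
    Retract (M.comap f) (N.comap f) :=
  ρ.map ((Functor.whiskeringLeft Q P (ModuleCat.{u} 𝕜)).obj f.monotone.functor)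

/-- Pointwise duality preserves retracts. -/
def retractDual (ρ : Retract M N) : Retract M.dual N.dual where
  i := dualMap ρ.r
  r := dualMap ρ.i
  retract := NatTrans.ext <| funext fun _ => ModuleCat.hom_ext <|
    LinearMap.ext fun φ : Module.Dual 𝕜 _ => LinearMap.ext fun v =>
      congrArg φ (M.appLin_r_appLin_i ρ _ v)

end Basic

end PersistenceModule

/-- A direct summand of `M` isomorphic to the interval module over `support`: `gen` consists of the
images of `1` under the inclusion of the interval module, and `coord` is the retraction. -/
structure IntervalSummand {𝕜 : Type u} [Field 𝕜] {P : Type w} [PartialOrder P]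
    (M : PersistenceModule 𝕜 P) where
  support : Set P
  gen : ∀ x, M.stalk x
  coord : ∀ x, Module.Dual 𝕜 (M.stalk x)
  gen_of_notMem : ∀ ⦃x⦄, x ∉ support → gen x = 0
  coord_of_notMem : ∀ ⦃x⦄, x ∉ support → coord x = 0
  coord_gen : ∀ ⦃x⦄, x ∈ support → coord x (gen x) = 1
  tr_gen : ∀ ⦃x y⦄ (h : x ≤ y), x ∈ support → M.tr h (gen x) = gen y
  coord_tr : ∀ ⦃x y⦄ (h : x ≤ y), y ∈ support → ∀ v, coord y (M.tr h v) = coord x v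

namespace IntervalSummand

open PersistenceModule

variable {𝕜 : Type u} [Field 𝕜] {P Q : Type w} [PartialOrder P] [PartialOrder Q]
  {M N : PersistenceModule 𝕜 P}

theorem mem_support_of_coord_gen_ne_zero (s : IntervalSummand M) {x : P}
    (h : s.coord x (s.gen x) ≠ 0) : x ∈ s.support :=
  not_imp_comm.1 (fun hx => by rw [s.gen_of_notMem hx, map_zero]) h

theorem ordConnected_support (s : IntervalSummand M) : s.support.OrdConnected where
  out' x hx z hz y hy := s.mem_support_of_coord_gen_ne_zero <| by
    rw [← s.coord_tr hy.2 hz, ← s.tr_gen hy.1 hx, M.tr_tr, s.tr_gen (hy.1.trans hy.2) hx,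
      s.coord_gen hz]
    exact one_ne_zero

/-- An interval summand of a direct summand is an interval summand. -/
@[simps]
def ofRetract (ρ : Retract M N) (s : IntervalSummand M) : IntervalSummand N where
  support := s.support
  gen x := appLin ρ.i x (s.gen x)
  coord x := s.coord x ∘ₗ appLin ρ.r x
  gen_of_notMem x hx := by rw [s.gen_of_notMem hx, map_zero]
  coord_of_notMem x hx := by rw [s.coord_of_notMem hx, LinearMap.zero_comp]
  coord_gen x hx := by
    rw [LinearMap.comp_apply, M.appLin_r_appLin_i, s.coord_gen hx]
  tr_gen x y h hx := by rw [← appLin_tr, s.tr_gen h hx]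
  coord_tr x y h hy v := by
    rw [LinearMap.comp_apply, appLin_tr, s.coord_tr h hy, LinearMap.comp_apply]

/-- Interval summands are transported along an isomorphism `f` of posets with inverse `g`. -/
@[simps support]
def ofComap (f : Q →o P) (g : P →o Q) (hfg : ∀ x, f (g x) = x)
    (s : IntervalSummand (M.comap f)) : IntervalSummand M where
  support := g ⁻¹' s.support
  gen x := M.tr (hfg x).le (s.gen (g x))
  coord x := s.coord (g x) ∘ₗ M.tr (hfg x).ge
  gen_of_notMem x hx := by rw [s.gen_of_notMem hx, map_zero]
  coord_of_notMem x hx := by rw [s.coord_of_notMem hx, LinearMap.zero_comp]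
  coord_gen x hx := by
    rw [LinearMap.comp_apply, M.tr_tr, M.tr_refl, s.coord_gen hx]
  tr_gen x y h hx := by
    rw [← s.tr_gen (g.monotone h) hx, M.comap_tr, M.tr_tr, M.tr_tr]
  coord_tr x y h hy v := by
    rw [LinearMap.comp_apply, LinearMap.comp_apply, ← s.coord_tr (g.monotone h) hy,
      M.comap_tr, M.tr_tr, M.tr_tr]

/-- Interval summands of the dual of a pointwise finite-dimensional module dualize to interval
summands of the module: generators and coordinates change roles. -/
@[simps support coord]
noncomputable def ofDual [∀ x, FiniteDimensional 𝕜 (M.stalk x)] (s : IntervalSummand M.dual) :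
    IntervalSummand M where
  support := OrderDual.toDual ⁻¹' s.support
  gen x := (Module.evalEquiv 𝕜 (M.stalk x)).symm (s.coord (OrderDual.toDual x))
  coord x := s.gen (OrderDual.toDual x)
  gen_of_notMem _ hx := (congrArg _ (s.coord_of_notMem hx)).trans (map_zero _)
  coord_of_notMem _ hx := s.gen_of_notMem hx
  coord_gen x hx := (Module.apply_evalEquiv_symm_apply 𝕜 (M.stalk x) _ _).trans (s.coord_gen hx)
  tr_gen _ _ h hx := (LinearEquiv.eq_symm_apply _).2 <| LinearMap.ext fun ψ =>
    (Module.apply_evalEquiv_symm_apply 𝕜 _ (ψ ∘ₗ M.tr h) _).trans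
      (s.coord_tr (OrderDual.toDual_le_toDual.2 h) hx ψ)
  coord_tr _ _ h hy := LinearMap.congr_fun (s.tr_gen (OrderDual.toDual_le_toDual.2 h) hy)

end IntervalSummand

section Extension

open PersistenceModule

variable {𝕜 : Type u} [Field 𝕜] {P : Type w} [PartialOrder P] {M : PersistenceModule 𝕜 P}

theorem PersistenceModule.exists_compatible_functionals [IsDirectedOrder P] {x : P}
    (φ : Module.Dual 𝕜 (M.stalk x))
    (hφ : ∀ y (h : x ≤ y), LinearMap.ker (M.tr h) ≤ LinearMap.ker φ) :
    ∃ Φ : ∀ y, Module.Dual 𝕜 (M.stalk y), Φ x = φ ∧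
      ∀ ⦃y z⦄ (h : y ≤ z) v, Φ z (M.tr h v) = Φ y v := by
  classical
  let f (y z : P) (h : y ≤ z) : M.stalk y →ₗ[𝕜] M.stalk z := M.tr h
  have : DirectedSystem (fun y => M.stalk y) (fun y z h => f y z h) :=
    ⟨fun _ => M.tr_refl _, fun _ _ _ _ _ => M.tr_tr _ _⟩
  let ι (y : P) := Module.DirectLimit.of 𝕜 P (fun y => M.stalk y) f y
  have hι : LinearMap.ker (ι x) ≤ LinearMap.ker φ := fun v hv => by
    obtain ⟨y, hxy, hvy⟩ := Module.DirectLimit.of.zero_exact (LinearMap.mem_ker.1 hv)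
    exact hφ y hxy hvy
  obtain ⟨ψ, hψ⟩ := exists_comp_eq_of_ker_le_ker hι
  refine ⟨fun y => ψ ∘ₗ ι y, hψ, fun y z h v => ?_⟩
  exact congrArg ψ Module.DirectLimit.of_f

theorem IntervalSummand.exists_of_isAdaptedPair_ker [OrderBot P] {e : M.stalk ⊥}
    {φ : Module.Dual 𝕜 (M.stalk ⊥)}
    (h : IsAdaptedPair e φ (Set.range fun x => LinearMap.ker (M.tr (bot_le : ⊥ ≤ x))))
    (hdir : DirectedOn (· ≤ ·) {x | LinearMap.ker (M.tr (bot_le : ⊥ ≤ x)) ≤ LinearMap.ker φ}) :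
    ∃ s : IntervalSummand M, s.gen ⊥ = e ∧ s.coord ⊥ = φ ∧
      s.support = {x | LinearMap.ker (M.tr (bot_le : ⊥ ≤ x)) ≤ LinearMap.ker φ} := by
  classical
  set U := {x | LinearMap.ker (M.tr (bot_le : ⊥ ≤ x)) ≤ LinearMap.ker φ}
  have hbot : ⊥ ∈ U := fun v hv => by
    rw [← M.tr_refl bot_le v, LinearMap.mem_ker.1 hv]
    exact zero_mem _
  have hlower {x y : P} (hxy : x ≤ y) (hy : y ∈ U) : x ∈ U :=
    (M.ker_tr_le_ker_tr bot_le hxy).trans hy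
  have : IsDirectedOrder U := ⟨hdir.directed_val⟩
  obtain ⟨Φ, hΦ_bot, hΦ⟩ := exists_compatible_functionals
    (M := M.restrict U) (x := ⟨⊥, hbot⟩) φ fun y _ => y.2
  have hΦ' {y : P} (hy : y ∈ U) (v) : Φ ⟨y, hy⟩ (M.tr bot_le v) = φ v :=
    (hΦ (y := ⟨⊥, hbot⟩) (z := ⟨y, hy⟩) bot_le v).trans (LinearMap.congr_fun hΦ_bot v)
  let s : IntervalSummand M :=
    { support := U
      gen x := M.tr bot_le e
      coord x := if hx : x ∈ U then Φ ⟨x, hx⟩ else 0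
      gen_of_notMem x hx := (h.mem_or_le_ker _ ⟨x, rfl⟩).resolve_right hx
      coord_of_notMem x hx := dif_neg hx
      coord_gen x hx := by rw [dif_pos hx, hΦ' hx, h.apply_eq_one]
      tr_gen x y hxy _ := M.tr_tr bot_le hxy e
      coord_tr x y hxy hy v := by
        rw [dif_pos hy, dif_pos (hlower hxy hy)]
        exact hΦ (y := ⟨x, hlower hxy hy⟩) (z := ⟨y, hy⟩) hxy v }
  exact ⟨s, M.tr_refl _ e, (dif_pos hbot).trans hΦ_bot, rfl⟩

theorem IntervalSummand.exists_of_isAdaptedPair_range [OrderTop P] (hM : M.IsPFD) {e : M.stalk ⊤}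
    {φ : Module.Dual 𝕜 (M.stalk ⊤)}
    (h : IsAdaptedPair e φ (Set.range fun x => LinearMap.range (M.tr (le_top : x ≤ ⊤))))
    (hdir : DirectedOn (· ≥ ·) {x | e ∈ LinearMap.range (M.tr (le_top : x ≤ ⊤))}) :
    ∃ s : IntervalSummand M, s.gen ⊤ = e ∧ s.coord ⊤ = φ ∧
      s.support = {x | e ∈ LinearMap.range (M.tr (le_top : x ≤ ⊤))} := by
  have : ∀ x, FiniteDimensional 𝕜 (M.stalk x) := hM
  have hker (x : P) : LinearMap.ker (M.dual.tr (bot_le : ⊥ ≤ OrderDual.toDual x)) ≤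
      LinearMap.ker (Module.Dual.eval 𝕜 (M.stalk ⊤) e) ↔
      e ∈ LinearMap.range (M.tr (le_top : x ≤ ⊤)) := ker_dualMap_le_ker_eval_iff
  have hadapted : IsAdaptedPair (V := M.dual.stalk ⊥) φ (Module.Dual.eval 𝕜 (M.stalk ⊤) e)
      (Set.range fun x => LinearMap.ker (M.dual.tr (bot_le : ⊥ ≤ x))) := by
    refine ⟨h.apply_eq_one, ?_⟩
    rintro _ ⟨x, rfl⟩
    refine (h.mem_or_le_ker _ ⟨OrderDual.ofDual x, rfl⟩).symm.imp (fun hx => ?_) (hker _).2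
    exact LinearMap.ext fun v => hx ⟨v, rfl⟩
  obtain ⟨s, hgen, hcoord, hsupp⟩ := exists_of_isAdaptedPair_ker hadapted fun x hx y hy => by
    obtain ⟨z, hz, hzx, hzy⟩ := hdir _ ((hker _).1 hx) _ ((hker _).1 hy)
    exact ⟨OrderDual.toDual z, (hker z).2 hz, hzx, hzy⟩
  refine ⟨ofDual s, (LinearEquiv.symm_apply_eq _).2 hcoord, hgen, ?_⟩
  rw [ofDual_support, hsupp]
  exact Set.ext hker

open Classical in
/-- Interval summands of the restrictions to `Set.Iic x` and `Set.Ici x` that agree at `x` glue, if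
every element is comparable to `x`. -/
noncomputable def IntervalSummand.glue {x : P} (hx : ∀ y, y ≤ x ∨ x ≤ y)
    (s : IntervalSummand (M.restrict (Set.Iic x))) (t : IntervalSummand (M.restrict (Set.Ici x)))
    (hs : ⊤ ∈ s.support) (ht : ⊥ ∈ t.support)
    (hgen : s.gen ⊤ = t.gen ⊥) (hcoord : s.coord ⊤ = t.coord ⊥) :
    IntervalSummand M :=
  have hge {y : P} (hy : ¬y ≤ x) : x ≤ y := (hx y).resolve_left hy
  { support := {y | if hy : y ≤ x then ⟨y, hy⟩ ∈ s.support else ⟨y, hge hy⟩ ∈ t.support}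
    gen y := if hy : y ≤ x then s.gen ⟨y, hy⟩ else t.gen ⟨y, hge hy⟩
    coord y := if hy : y ≤ x then s.coord ⟨y, hy⟩ else t.coord ⟨y, hge hy⟩
    gen_of_notMem y hy := by
      by_cases hyx : y ≤ x
      · exact (dif_pos hyx).trans (s.gen_of_notMem (by simpa [hyx] using hy))
      · exact (dif_neg hyx).trans (t.gen_of_notMem (by simpa [hyx] using hy))
    coord_of_notMem y hy := by
      by_cases hyx : y ≤ x
      · exact (dif_pos hyx).trans (s.coord_of_notMem (by simpa [hyx] using hy))
      · exact (dif_neg hyx).trans (t.coord_of_notMem (by simpa [hyx] using hy))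
    coord_gen y hy := by
      by_cases hyx : y ≤ x
      · simpa [hyx] using s.coord_gen (by simpa [hyx] using hy)
      · simpa [hyx] using t.coord_gen (by simpa [hyx] using hy)
    tr_gen y z hyz hy := by
      by_cases hzx : z ≤ x
      · have hyx := hyz.trans hzx
        simpa [hyx, hzx] using! s.tr_gen (y := ⟨z, hzx⟩) hyz (by simpa [hyx] using hy)
      by_cases hyx : y ≤ x
      · have hs_gen := s.tr_gen (y := ⊤) hyx (by simpa [hyx] using hy)
        have ht_gen := t.tr_gen (y := ⟨z, hge hzx⟩) (hge hzx) ht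
        rw [← hgen, ← hs_gen] at ht_gen
        simpa [hyx, hzx] using! (M.tr_tr _ _ _).symm.trans ht_gen
      · simpa [hyx, hzx] using! t.tr_gen (y := ⟨z, hge hzx⟩) hyz (by simpa [hyx] using hy)
    coord_tr y z hyz hz v := by
      by_cases hzx : z ≤ x
      · have hyx := hyz.trans hzx
        simpa [hyx, hzx] using! s.coord_tr (x := ⟨y, hyx⟩) hyz (by simpa [hzx] using hz) v
      by_cases hyx : y ≤ x
      · have hs_coord := s.coord_tr (x := ⟨y, hyx⟩) (y := ⊤) hyx hs v
        have ht_coord := t.coord_tr (x := ⊥) (hge hzx) (by simpa [hzx] using hz) (M.tr hyx v)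
        rw [← hcoord] at ht_coord
        simpa [hyx, hzx] using! ht_coord.trans hs_coord
      · simpa [hyx, hzx] using! t.coord_tr (x := ⟨y, hge hyx⟩) hyz (by simpa [hzx] using hz) v }

theorem IntervalSummand.mem_support_glue {x : P} {hx : ∀ y, y ≤ x ∨ x ≤ y}
    {s : IntervalSummand (M.restrict (Set.Iic x))} {t : IntervalSummand (M.restrict (Set.Ici x))}
    {hs : ⊤ ∈ s.support} {ht : ⊥ ∈ t.support}
    {hgen : s.gen ⊤ = t.gen ⊥} {hcoord : s.coord ⊤ = t.coord ⊥} :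
    x ∈ (glue hx s t hs ht hgen hcoord).support :=
  (dif_pos le_rfl).mpr hs

end Extension

section LinearOrder

open IntervalSummand

variable {𝕜 : Type u} [Field 𝕜] {α : Type w} [LinearOrder α] {M : PersistenceModule 𝕜 α}

theorem exists_isAdaptedPair_of_linearOrder (hM : M.IsPFD) {x : α} [Nontrivial (M.stalk x)] :
    ∃ (e : M.stalk x) (φ : Module.Dual 𝕜 (M.stalk x)), IsAdaptedPair e φ
      ((Set.range fun y : Set.Iic x => LinearMap.range (M.tr y.2)) ∪
        Set.range fun y : Set.Ici x => LinearMap.ker (M.tr y.2)) := by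
  have := hM x
  refine exists_isAdaptedPair_union_of_isChain (Monotone.isChain_range fun y z hyz => ?_)
    (Monotone.isChain_range fun y z hyz => ?_)
  · exact M.range_tr_le_range_tr hyz z.2
  · exact M.ker_tr_le_ker_tr y.2 hyz

theorem PersistenceModule.IsPFD.exists_intervalSummand_of_linearOrder (hM : M.IsPFD) {x : α}
    [Nontrivial (M.stalk x)] : ∃ s : IntervalSummand M, x ∈ s.support := by
  obtain ⟨e, φ, h⟩ := exists_isAdaptedPair_of_linearOrder hM (x := x)
  obtain ⟨s, hs_gen, hs_coord, -⟩ := exists_of_isAdaptedPair_range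
    (M := M.restrict (Set.Iic x)) (hM.comap _) (h.mono Set.subset_union_left)
    (isChain_of_trichotomous _).directedOn
  obtain ⟨t, ht_gen, ht_coord, -⟩ := exists_of_isAdaptedPair_ker
    (M := M.restrict (Set.Ici x)) (h.mono Set.subset_union_right)
    (isChain_of_trichotomous _).directedOn
  have hs : ⊤ ∈ s.support := s.mem_support_of_coord_gen_ne_zero <| by
    rw [hs_gen, hs_coord]
    exact h.apply_eq_one.trans_ne one_ne_zero
  have ht : ⊥ ∈ t.support := t.mem_support_of_coord_gen_ne_zero <| by
    rw [ht_gen, ht_coord]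
    exact h.apply_eq_one.trans_ne one_ne_zero
  exact ⟨glue (le_total · x) s t hs ht (hs_gen.trans ht_gen.symm) (hs_coord.trans ht_coord.symm),
    mem_support_glue⟩

end LinearOrder

section Blocks

theorem isPosetInterval_iff {α : Type w} [LinearOrder α] {J : Set α} :
    IsPosetInterval J ↔ J.Nonempty ∧ J.OrdConnected where
  mp h := ⟨h.nonempty, ⟨fun _ hx _ hy _ hz => h.convex hx hy hz.1 hz.2⟩⟩
  mpr h := ⟨h.1, fun _ _ _ hx hy hxz hzy => h.2.out hx hy ⟨hxz, hzy⟩,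
    fun x y hx hy => .single ⟨hx, hy, le_total x y⟩⟩

theorem IsPosetInterval.prod {P Q : Type w} [PartialOrder P] [PartialOrder Q] {I : Set P}
    {J : Set Q} (hI : IsPosetInterval I) (hJ : IsPosetInterval J) : IsPosetInterval (I ×ˢ J) where
  nonempty := hI.nonempty.prod hJ.nonempty
  convex _ _ _ hx hy hxz hzy :=
    ⟨hI.convex hx.1 hy.1 hxz.1 hzy.1, hJ.convex hx.2 hy.2 hxz.2 hzy.2⟩
  connected x y hx hy := by
    refine .trans (b := (y.1, x.2)) ?_ ?_
    · exact (hI.connected hx.1 hy.1).lift (·, x.2) fun a b ⟨ha, hb, hab⟩ =>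
        ⟨⟨ha, hx.2⟩, ⟨hb, hx.2⟩, hab.imp (⟨·, le_rfl⟩) (⟨·, le_rfl⟩)⟩
    · exact (hJ.connected hx.2 hy.2).lift (y.1, ·) fun a b ⟨ha, hb, hab⟩ =>
        ⟨⟨hy.1, ha⟩, ⟨hy.1, hb⟩, hab.imp (⟨le_rfl, ·⟩) (⟨le_rfl, ·⟩)⟩

variable {α β : Type w} [LinearOrder α] [LinearOrder β]

/-- A nonempty product of two down-closed subsets: a death block. -/
def IsLowerBlock (I : Set (α × β)) : Prop :=
  IsPosetInterval I ∧ ∃ (J₁ : Set α) (J₂ : Set β), IsLowerSet J₁ ∧ IsLowerSet J₂ ∧ I = J₁ ×ˢ J₂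

/-- A nonempty product of two up-closed subsets: a birth block. -/
def IsUpperBlock (I : Set (α × β)) : Prop :=
  IsPosetInterval I ∧ ∃ (J₁ : Set α) (J₂ : Set β), IsUpperSet J₁ ∧ IsUpperSet J₂ ∧ I = J₁ ×ˢ J₂

/-- The product of an interval of `α` with all of `β`: a vertical block. -/
def IsVerticalStrip (I : Set (α × β)) : Prop :=
  IsPosetInterval I ∧ ∃ J : Set α, IsPosetInterval J ∧ I = J ×ˢ Set.univ

/-- The product of all of `α` with an interval of `β`: a horizontal block. -/
def IsHorizontalStrip (I : Set (α × β)) : Prop :=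
  IsPosetInterval I ∧ ∃ J : Set β, IsPosetInterval J ∧ I = Set.univ ×ˢ J

theorem isUpperBlock_prod {J₁ : Set α} {J₂ : Set β} (hne : (J₁ ×ˢ J₂).Nonempty)
    (h₁ : IsUpperSet J₁) (h₂ : IsUpperSet J₂) : IsUpperBlock (J₁ ×ˢ J₂) :=
  ⟨(isPosetInterval_iff.2 ⟨hne.fst, h₁.ordConnected⟩).prod
    (isPosetInterval_iff.2 ⟨hne.snd, h₂.ordConnected⟩), J₁, J₂, h₁, h₂, rfl⟩

theorem isVerticalStrip_prod [Nonempty β] {J : Set α} (hJ : IsPosetInterval J) :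
    IsVerticalStrip (J ×ˢ (Set.univ : Set β)) :=
  ⟨hJ.prod (isPosetInterval_iff.2 ⟨Set.univ_nonempty, Set.ordConnected_univ⟩), J, hJ, rfl⟩

theorem isHorizontalStrip_prod [Nonempty α] {J : Set β} (hJ : IsPosetInterval J) :
    IsHorizontalStrip ((Set.univ : Set α) ×ˢ J) :=
  ⟨(isPosetInterval_iff.2 ⟨Set.univ_nonempty, Set.ordConnected_univ⟩).prod hJ, J, hJ, rfl⟩

theorem IsVerticalStrip.preimage_swap {I : Set (α × β)} (hI : IsVerticalStrip I) :
    IsHorizontalStrip (Prod.swap ⁻¹' I) := by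
  obtain ⟨⟨⟨⟨_, b⟩, _⟩, _, _⟩, J, hJ, rfl⟩ := hI
  have : Nonempty β := ⟨b⟩
  exact Set.preimage_swap_prod J Set.univ ▸ isHorizontalStrip_prod hJ

theorem IsPosetInterval.preimage_toDual {J : Set αᵒᵈ} (hJ : IsPosetInterval J) :
    IsPosetInterval (OrderDual.toDual ⁻¹' J) :=
  isPosetInterval_iff.2 ((isPosetInterval_iff.1 hJ).imp id (·.dual))

theorem IsUpperBlock.preimage_toDual {I : Set (αᵒᵈ × βᵒᵈ)} (hI : IsUpperBlock I) :
    IsLowerBlock (Prod.map OrderDual.toDual OrderDual.toDual ⁻¹' I) := by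
  obtain ⟨h, J₁, J₂, h₁, h₂, rfl⟩ := hI
  exact ⟨(isPosetInterval_iff.2 ⟨h.nonempty.fst, h₁.ordConnected⟩).preimage_toDual.prod
    (isPosetInterval_iff.2 ⟨h.nonempty.snd, h₂.ordConnected⟩).preimage_toDual, _, _,
    h₁.toDual, h₂.toDual, rfl⟩

theorem IsVerticalStrip.preimage_toDual {I : Set (αᵒᵈ × βᵒᵈ)} (hI : IsVerticalStrip I) :
    IsVerticalStrip (Prod.map OrderDual.toDual OrderDual.toDual ⁻¹' I) := by
  obtain ⟨⟨⟨⟨_, b⟩, _⟩, _, _⟩, J, hJ, rfl⟩ := hI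
  have : Nonempty β := ⟨OrderDual.ofDual b⟩
  exact isVerticalStrip_prod hJ.preimage_toDual

theorem IsHorizontalStrip.preimage_toDual {I : Set (αᵒᵈ × βᵒᵈ)} (hI : IsHorizontalStrip I) :
    IsHorizontalStrip (Prod.map OrderDual.toDual OrderDual.toDual ⁻¹' I) := by
  obtain ⟨⟨⟨⟨a, _⟩, _⟩, _, _⟩, J, hJ, rfl⟩ := hI
  have : Nonempty α := ⟨OrderDual.ofDual a⟩
  exact isHorizontalStrip_prod hJ.preimage_toDual

end Blocks

section TopCartesian

open IntervalSummand

variable {𝕜 : Type u} [Field 𝕜] {α β : Type w} [LinearOrder α] [LinearOrder β]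
  [OrderTop α] [OrderTop β]

/-- The squares of a persistence module with upper right corner `⊤` are pullbacks, in terms of
elements. -/
def PersistenceModule.IsTopCartesian (M : PersistenceModule 𝕜 (α × β)) : Prop :=
  ∀ (a : α) (b : β) (u : M.stalk (a, ⊤)) (v : M.stalk (⊤, b)),
    M.tr le_top u = M.tr (y := ⊤) le_top v → ∃! w : M.stalk (a, b),
      M.tr (Prod.mk_le_mk.2 ⟨le_rfl, le_top⟩) w = u ∧
      M.tr (Prod.mk_le_mk.2 ⟨le_top, le_rfl⟩) w = v

/-- The top edge `a ↦ (a, ⊤)` of a product. -/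
def topEdge (α β : Type w) [PartialOrder α] [PartialOrder β] [OrderTop β] : α →o α × β :=
  ⟨fun a => (a, ⊤), fun _ _ h => ⟨h, le_rfl⟩⟩

/-- The interchange of factors, as a monotone map. -/
def prodSwap (α β : Type w) [PartialOrder α] [PartialOrder β] : α × β →o β × α :=
  ⟨Prod.swap, fun _ _ h => h.symm⟩

namespace PersistenceModule.IsTopCartesian

variable {M N : PersistenceModule 𝕜 (α × β)}

theorem comap_prodSwap (hM : M.IsTopCartesian) : (M.comap (prodSwap β α)).IsTopCartesian := by
  intro b a v u h
  obtain ⟨w, hw, hw'⟩ := hM a b u v h.symm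
  exact ⟨w, hw.symm, fun w₂ hw₂ => hw' w₂ hw₂.symm⟩

theorem of_retract (ρ : Retract M N) (hN : N.IsTopCartesian) : M.IsTopCartesian := by
  intro a b u v huv
  obtain ⟨w, ⟨hwu, hwv⟩, hw⟩ := hN a b (appLin ρ.i _ u) (appLin ρ.i _ v) (by
    rw [← appLin_tr, huv, appLin_tr])
  refine ⟨appLin ρ.r _ w, ⟨?_, ?_⟩, ?_⟩
  · rw [← appLin_tr, hwu, M.appLin_r_appLin_i]
  · rw [← appLin_tr, hwv, M.appLin_r_appLin_i]
  · rintro w' ⟨rfl, rfl⟩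
    rw [← hw (appLin ρ.i _ w') ⟨(appLin_tr _ _ _).symm, (appLin_tr _ _ _).symm⟩,
      M.appLin_r_appLin_i]

theorem mem_range_tr_iff (hM : M.IsTopCartesian) {p : α × β} {e : M.stalk ⊤} :
    e ∈ LinearMap.range (M.tr (le_top : p ≤ ⊤)) ↔
      e ∈ LinearMap.range (M.tr (le_top : (p.1, ⊤) ≤ ⊤)) ∧
      e ∈ LinearMap.range (M.tr (le_top : (⊤, p.2) ≤ ⊤)) := by
  constructor
  · exact fun he => ⟨M.range_tr_le_range_tr (x := p) (y := (p.1, ⊤)) ⟨le_rfl, le_top⟩ le_top he,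
      M.range_tr_le_range_tr (x := p) (y := (⊤, p.2)) ⟨le_top, le_rfl⟩ le_top he⟩
  · rintro ⟨⟨u, rfl⟩, v, hv⟩
    obtain ⟨w, ⟨rfl, -⟩, -⟩ := hM p.1 p.2 u v hv.symm
    exact ⟨w, (M.tr_tr _ _ w).symm⟩

theorem nontrivial_stalk_edge (hM : M.IsTopCartesian) {p : α × β} [Nontrivial (M.stalk p)] :
    Nontrivial (M.stalk (p.1, ⊤)) ∨ Nontrivial (M.stalk (⊤, p.2)) := by
  by_contra! h
  obtain ⟨_, _⟩ := h
  obtain ⟨w, hw⟩ := exists_ne (0 : M.stalk p)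
  have := (hM p.1 p.2 0 0 (by rw [map_zero, map_zero])).unique (y₁ := w)
    ⟨Subsingleton.elim _ _, Subsingleton.elim _ _⟩ ⟨map_zero _, map_zero _⟩
  exact hw this

theorem exists_isUpperBlock (hM : M.IsTopCartesian) (hpfd : M.IsPFD)
    [Nontrivial (M.stalk ⊤)] : ∃ s : IntervalSummand M, IsUpperBlock s.support := by
  have := hpfd ⊤
  have hmono₁ : Monotone fun a : α => LinearMap.range (M.tr (le_top : (a, ⊤) ≤ ⊤)) :=
    fun a a' h => M.range_tr_le_range_tr (x := (a, ⊤)) (y := (a', ⊤)) ⟨h, le_rfl⟩ le_top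
  have hmono₂ : Monotone fun b : β => LinearMap.range (M.tr (le_top : (⊤, b) ≤ ⊤)) :=
    fun b b' h => M.range_tr_le_range_tr (x := (⊤, b)) (y := (⊤, b')) ⟨le_rfl, h⟩ le_top
  obtain ⟨e, φ, he⟩ := exists_isAdaptedPair_union_of_isChain hmono₁.isChain_range
    hmono₂.isChain_range
  have hadapted : IsAdaptedPair e φ
      (Set.range fun p => LinearMap.range (M.tr (le_top : p ≤ ⊤))) := by
    refine ⟨he.apply_eq_one, ?_⟩
    rintro _ ⟨p, rfl⟩
    obtain h₁ | h₁ := he.mem_or_le_ker _ (.inl ⟨p.1, rfl⟩)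
    · obtain h₂ | h₂ := he.mem_or_le_ker _ (.inr ⟨p.2, rfl⟩)
      · exact .inl (hM.mem_range_tr_iff.2 ⟨h₁, h₂⟩)
      · exact .inr fun v hv => h₂ (hM.mem_range_tr_iff.1 hv).2
    · exact .inr fun v hv => h₁ (hM.mem_range_tr_iff.1 hv).1
  have hprod : {p | e ∈ LinearMap.range (M.tr (le_top : p ≤ ⊤))} =
      {a : α | e ∈ LinearMap.range (M.tr (le_top : (a, ⊤) ≤ ⊤))} ×ˢ
        {b : β | e ∈ LinearMap.range (M.tr (le_top : (⊤, b) ≤ ⊤))} :=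
    Set.ext fun p => hM.mem_range_tr_iff
  obtain ⟨s, -, -, hs⟩ := exists_of_isAdaptedPair_range hpfd hadapted <| hprod ▸
    ((LinearOrder.infClosed _).prod (LinearOrder.infClosed _)).codirectedOn
  refine ⟨s, ?_⟩
  rw [hs, hprod]
  have htop : e ∈ LinearMap.range (M.tr (le_top : ⊤ ≤ ⊤)) := ⟨e, M.tr_refl _ e⟩
  exact isUpperBlock_prod ⟨⊤, htop, htop⟩ (fun _ _ h he => hmono₁ h he)
    fun _ _ h he => hmono₂ h he

theorem exists_support_eq_prod_univ (hM : M.IsTopCartesian) [Subsingleton (M.stalk ⊤)]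
    (s : IntervalSummand (M.comap (topEdge α β))) :
    ∃ t : IntervalSummand M, t.support = s.support ×ˢ Set.univ := by
  have hex (p : α × β) := hM p.1 p.2 (s.gen p.1) 0 (Subsingleton.elim _ _)
  choose g hg₁ hg₂ using fun p => (hex p).exists
  let t : IntervalSummand M :=
    { support := s.support ×ˢ Set.univ
      gen := g
      coord p := s.coord p.1 ∘ₗ M.tr (Prod.mk_le_mk.2 ⟨le_rfl, le_top⟩ : p ≤ (p.1, ⊤))
      gen_of_notMem p hp := (hex p).unique ⟨hg₁ p, hg₂ p⟩
        ⟨(map_zero _).trans (s.gen_of_notMem fun h => hp ⟨h, trivial⟩).symm, map_zero _⟩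
      coord_of_notMem p hp := by
        rw [s.coord_of_notMem fun h => hp ⟨h, trivial⟩, LinearMap.zero_comp]
      coord_gen p hp := (congrArg (s.coord p.1) (hg₁ p)).trans (s.coord_gen hp.1)
      tr_gen p q h hp := by
        refine (hex q).unique ⟨?_, ?_⟩ ⟨hg₁ q, hg₂ q⟩
        · rw [← s.tr_gen h.1 hp.1, ← hg₁ p]
          exact (M.tr_tr _ _ _).trans (M.tr_tr _ _ _).symm
        · rw [← map_zero (M.tr (Prod.mk_le_mk.2 ⟨le_rfl, h.2⟩ : (⊤, p.2) ≤ (⊤, q.2))), ← hg₂ p]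
          exact (M.tr_tr _ _ _).trans (M.tr_tr _ _ _).symm
      coord_tr p q h hq v := by
        refine .trans ?_ (s.coord_tr h.1 hq.1 _)
        exact congrArg (s.coord q.1) ((M.tr_tr _ _ _).trans (M.tr_tr _ _ _).symm) }
  exact ⟨t, rfl⟩

theorem exists_isVerticalStrip (hM : M.IsTopCartesian) (hpfd : M.IsPFD)
    [Subsingleton (M.stalk ⊤)] {a : α} [Nontrivial (M.stalk (a, ⊤))] :
    ∃ s : IntervalSummand M, IsVerticalStrip s.support := by
  have : Nontrivial ((M.comap (topEdge α β)).stalk a) := ‹_›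
  obtain ⟨s, hs⟩ := (hpfd.comap (topEdge α β)).exists_intervalSummand_of_linearOrder (x := a)
  obtain ⟨t, ht⟩ := hM.exists_support_eq_prod_univ s
  have : Nonempty β := ⟨⊤⟩
  exact ⟨t, ht ▸ isVerticalStrip_prod (isPosetInterval_iff.2 ⟨⟨a, hs⟩, s.ordConnected_support⟩)⟩

theorem exists_intervalSummand (hM : M.IsTopCartesian) (hpfd : M.IsPFD) {p : α × β}
    [Nontrivial (M.stalk p)] : ∃ s : IntervalSummand M,
      IsUpperBlock s.support ∨ IsVerticalStrip s.support ∨ IsHorizontalStrip s.support := by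
  cases subsingleton_or_nontrivial (M.stalk ⊤) with
  | inr => exact (hM.exists_isUpperBlock hpfd).imp fun _ => .inl
  | inl =>
    obtain _ | hp := hM.nontrivial_stalk_edge (p := p)
    · exact (hM.exists_isVerticalStrip hpfd (a := p.1)).imp fun _ => .inr ∘ .inl
    · have : Subsingleton ((M.comap (prodSwap β α)).stalk ⊤) := ‹Subsingleton (M.stalk ⊤)›
      have : Nontrivial ((M.comap (prodSwap β α)).stalk (p.2, ⊤)) := hp
      obtain ⟨s, hs⟩ := hM.comap_prodSwap.exists_isVerticalStrip (hpfd.comap _) (a := p.2)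
      exact ⟨s.ofComap (prodSwap β α) (prodSwap α β) fun _ => rfl, .inr (.inr hs.preimage_swap)⟩

end PersistenceModule.IsTopCartesian

end TopCartesian

section ProdDual

open OrderDual

variable {𝕜 : Type u} [Field 𝕜] {α β : Type w} [LinearOrder α] [LinearOrder β]

/-- The duality of a product of orders, from the product of the dual orders. -/
def toDualProd (α β : Type w) [PartialOrder α] [PartialOrder β] : αᵒᵈ × βᵒᵈ →o (α × β)ᵒᵈ :=
  ⟨fun p => toDual (ofDual p.1, ofDual p.2), fun _ _ h => h⟩

/-- The inverse of `toDualProd`. -/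
def ofDualProd (α β : Type w) [PartialOrder α] [PartialOrder β] : (α × β)ᵒᵈ →o αᵒᵈ × βᵒᵈ :=
  ⟨fun p => (toDual (ofDual p).1, toDual (ofDual p).2), fun _ _ h => h⟩

/-- The pointwise dual of a two-parameter persistence module, as a two-parameter persistence
module. -/
abbrev PersistenceModule.prodDual (M : PersistenceModule 𝕜 (α × β)) :
    PersistenceModule 𝕜 (αᵒᵈ × βᵒᵈ) :=
  M.dual.comap (toDualProd α β)

theorem PersistenceModule.exists_intervalSummand_of_isTopCartesian_prodDual [OrderBot α]
    [OrderBot β] {M : PersistenceModule 𝕜 (α × β)} (hM : M.prodDual.IsTopCartesian)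
    (hpfd : M.IsPFD) {p : α × β} [Nontrivial (M.stalk p)] : ∃ s : IntervalSummand M,
      IsLowerBlock s.support ∨ IsVerticalStrip s.support ∨ IsHorizontalStrip s.support := by
  have : ∀ x, FiniteDimensional 𝕜 (M.stalk x) := hpfd
  have : Nontrivial (M.prodDual.stalk (toDual p.1, toDual p.2)) :=
    inferInstanceAs (Nontrivial (Module.Dual 𝕜 (M.stalk p)))
  obtain ⟨s, hs⟩ := hM.exists_intervalSummand (hpfd.dual.comap _) (p := (toDual p.1, toDual p.2))
  exact ⟨(s.ofComap (toDualProd α β) (ofDualProd α β) fun _ => rfl).ofDual,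
    hs.imp (·.preimage_toDual) (.imp (·.preimage_toDual) (·.preimage_toDual))⟩

end ProdDual

section Cubes

namespace Cube

variable {C : Type u} [Category.{v} C] {X : Cube 2 C}

theorem le_zero_or_le_one_of_lt_univ :
    ∀ {U : Finset (Fin 2)}, U < Finset.univ → U ≤ {0} ∨ U ≤ {1} := by
  decide

theorem zero_le_or_one_le_of_empty_lt :
    ∀ {U : Finset (Fin 2)}, ∅ < U → {0} ≤ U ∨ {1} ≤ U := by
  decide

theorem IsCocartesian.exists_desc (hX : X.IsCocartesian) {Z : C} {f : X.obj {0} ⟶ Z}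
    {g : X.obj {1} ⟶ Z} (hfg : X.map (homOfLE (Finset.empty_subset {0})) ≫ f =
      X.map (homOfLE (Finset.empty_subset {1})) ≫ g) :
    ∃ d : X.obj Finset.univ ⟶ Z, X.map (homOfLE (Finset.subset_univ {0})) ≫ d = f ∧
      X.map (homOfLE (Finset.subset_univ {1})) ≫ d = g := by
  let leg (U : Finset (Fin 2)) (hU : U < Finset.univ) : X.obj U ⟶ Z :=
    if h : U ≤ {0} then X.map (homOfLE h) ≫ f
    else X.map (homOfLE ((le_zero_or_le_one_of_lt_univ hU).resolve_left h)) ≫ g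
  have leg_zero {U} (hU) (h : U ≤ {0}) : leg U hU = X.map (homOfLE h) ≫ f := dif_pos h
  have leg_one {U} (hU) (h : U ≤ {1}) : leg U hU = X.map (homOfLE h) ≫ g := by
    by_cases h₀ : U ≤ {0}
    · obtain rfl : U = ∅ := by
        revert U
        decide
      exact (leg_zero hU h₀).trans hfg
    · exact dif_neg h₀
  have map_leg {U V : Finset (Fin 2)} (hUV : U ≤ V) (hV : V < Finset.univ) :
      X.map (homOfLE hUV) ≫ leg V hV = leg U (hUV.trans_lt hV) := by
    obtain h | h := le_zero_or_le_one_of_lt_univ hV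
    · rw [leg_zero hV h, leg_zero (hUV.trans_lt hV) (hUV.trans h),
        ← X.map_comp_assoc, homOfLE_comp]
    · rw [leg_one hV h, leg_one (hUV.trans_lt hV) (hUV.trans h),
        ← X.map_comp_assoc, homOfLE_comp]
  let c : Cocone (X.lowerFace ∅ Finset.univ) :=
    ⟨Z, ⟨fun U => leg U.1 U.2.2, fun U V k =>
      (map_leg (leOfHom k) V.2.2).trans (Category.comp_id _).symm⟩⟩
  obtain ⟨hcolim⟩ := hX
  refine ⟨hcolim.desc c, ?_, ?_⟩
  · refine (hcolim.fac c ⟨{0}, by decide⟩).trans ((leg_zero (by decide) le_rfl).trans ?_)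
    exact (congrArg (· ≫ f) (X.map_id _)).trans (Category.id_comp f)
  · refine (hcolim.fac c ⟨{1}, by decide⟩).trans ((leg_one (by decide) le_rfl).trans ?_)
    exact (congrArg (· ≫ g) (X.map_id _)).trans (Category.id_comp g)

theorem IsCocartesian.hom_ext (hX : X.IsCocartesian) {Z : C} {d d' : X.obj Finset.univ ⟶ Z}
    (h₀ : X.map (homOfLE (Finset.subset_univ {0})) ≫ d =
      X.map (homOfLE (Finset.subset_univ {0})) ≫ d')
    (h₁ : X.map (homOfLE (Finset.subset_univ {1})) ≫ d =
      X.map (homOfLE (Finset.subset_univ {1})) ≫ d') : d = d' := by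
  obtain ⟨hcolim⟩ := hX
  refine hcolim.hom_ext fun U => ?_
  have hU := U.2.2
  change X.map (homOfLE hU.le) ≫ d = X.map (homOfLE hU.le) ≫ d'
  obtain h | h := le_zero_or_le_one_of_lt_univ hU
  · rw [← homOfLE_comp h (Finset.subset_univ _), X.map_comp_assoc, X.map_comp_assoc, h₀]
  · rw [← homOfLE_comp h (Finset.subset_univ _), X.map_comp_assoc, X.map_comp_assoc, h₁]

theorem IsCocartesian.isPushout (hX : X.IsCocartesian) :
    IsPushout (X.map (homOfLE (Finset.empty_subset {0})))
      (X.map (homOfLE (Finset.empty_subset {1})))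
      (X.map (homOfLE (Finset.subset_univ {0}))) (X.map (homOfLE (Finset.subset_univ {1}))) where
  w := by simp only [← X.map_comp, homOfLE_comp]
  isColimit' := ⟨PushoutCocone.isColimitAux' _ fun s =>
    have h := hX.exists_desc s.condition
    ⟨h.choose, h.choose_spec.1, h.choose_spec.2, fun h₀ h₁ =>
      hX.hom_ext (h₀.trans h.choose_spec.1.symm) (h₁.trans h.choose_spec.2.symm)⟩⟩

theorem IsCartesian.exists_lift (hX : X.IsCartesian) {Z : C} {f : Z ⟶ X.obj {0}}
    {g : Z ⟶ X.obj {1}} (hfg : f ≫ X.map (homOfLE (Finset.subset_univ {0})) =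
      g ≫ X.map (homOfLE (Finset.subset_univ {1}))) :
    ∃ l : Z ⟶ X.obj ∅, l ≫ X.map (homOfLE (Finset.empty_subset {0})) = f ∧
      l ≫ X.map (homOfLE (Finset.empty_subset {1})) = g := by
  let leg (U : Finset (Fin 2)) (hU : ∅ < U) : Z ⟶ X.obj U :=
    if h : {0} ≤ U then f ≫ X.map (homOfLE h)
    else g ≫ X.map (homOfLE ((zero_le_or_one_le_of_empty_lt hU).resolve_left h))
  have leg_zero {U} (hU) (h : {0} ≤ U) : leg U hU = f ≫ X.map (homOfLE h) := dif_pos h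
  have leg_one {U} (hU) (h : {1} ≤ U) : leg U hU = g ≫ X.map (homOfLE h) := by
    by_cases h₀ : {0} ≤ U
    · obtain rfl : U = Finset.univ := by
        revert U
        decide
      exact (leg_zero hU h₀).trans hfg
    · exact dif_neg h₀
  have leg_map {U V : Finset (Fin 2)} (hU : ∅ < U) (hUV : U ≤ V) :
      leg U hU ≫ X.map (homOfLE hUV) = leg V (hU.trans_le hUV) := by
    obtain h | h := zero_le_or_one_le_of_empty_lt hU
    · rw [leg_zero hU h, leg_zero (hU.trans_le hUV) (h.trans hUV),
        Category.assoc, ← X.map_comp, homOfLE_comp]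
    · rw [leg_one hU h, leg_one (hU.trans_le hUV) (h.trans hUV),
        Category.assoc, ← X.map_comp, homOfLE_comp]
  let c : Cone (X.upperFace ∅ Finset.univ) :=
    ⟨Z, ⟨fun U => leg U.1 U.2.1, fun U V k =>
      (Category.id_comp _).trans (leg_map U.2.1 (leOfHom k)).symm⟩⟩
  obtain ⟨hlim⟩ := hX
  refine ⟨hlim.lift c, ?_, ?_⟩
  · refine (hlim.fac c ⟨{0}, by decide⟩).trans ((leg_zero (by decide) le_rfl).trans ?_)
    exact (congrArg (f ≫ ·) (X.map_id _)).trans (Category.comp_id f)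
  · refine (hlim.fac c ⟨{1}, by decide⟩).trans ((leg_one (by decide) le_rfl).trans ?_)
    exact (congrArg (g ≫ ·) (X.map_id _)).trans (Category.comp_id g)

theorem IsCartesian.hom_ext (hX : X.IsCartesian) {Z : C} {l l' : Z ⟶ X.obj ∅}
    (h₀ : l ≫ X.map (homOfLE (Finset.empty_subset {0})) =
      l' ≫ X.map (homOfLE (Finset.empty_subset {0})))
    (h₁ : l ≫ X.map (homOfLE (Finset.empty_subset {1})) =
      l' ≫ X.map (homOfLE (Finset.empty_subset {1}))) : l = l' := by
  obtain ⟨hlim⟩ := hX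
  refine hlim.hom_ext fun U => ?_
  have hU := U.2.1
  change l ≫ X.map (homOfLE hU.le) = l' ≫ X.map (homOfLE hU.le)
  obtain h | h := zero_le_or_one_le_of_empty_lt hU
  · rw [← homOfLE_comp (Finset.empty_subset _) h, X.map_comp, reassoc_of% h₀]
  · rw [← homOfLE_comp (Finset.empty_subset _) h, X.map_comp, reassoc_of% h₁]

theorem IsCartesian.isPullback (hX : X.IsCartesian) :
    IsPullback (X.map (homOfLE (Finset.empty_subset {0})))
      (X.map (homOfLE (Finset.empty_subset {1})))
      (X.map (homOfLE (Finset.subset_univ {0}))) (X.map (homOfLE (Finset.subset_univ {1}))) where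
  w := by simp only [← X.map_comp, homOfLE_comp]
  isLimit' := ⟨PullbackCone.isLimitAux' _ fun s =>
    have h := hX.exists_lift s.condition
    ⟨h.choose, h.choose_spec.1, h.choose_spec.2, fun h₀ h₁ =>
      hX.hom_ext (h₀.trans h.choose_spec.1.symm) (h₁.trans h.choose_spec.2.symm)⟩⟩

end Cube

section Square

variable {P : Type w} [DistribLattice P]

/-- The 2-cube spanned by two elements of a lattice. -/
def squareCube (x y : P) : Cube 2 P :=
  Monotone.functor (f := fun U : Finset (Fin 2) =>
    if 0 ∈ U then if 1 ∈ U then x ⊔ y else x else if 1 ∈ U then y else x ⊓ y) <| by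
      intro U V h
      have h₀ : 0 ∈ U → 0 ∈ V := fun hU => h hU
      have h₁ : 1 ∈ U → 1 ∈ V := fun hU => h hU
      have : x ⊓ y ≤ x ⊔ y := inf_le_left.trans le_sup_left
      dsimp only
      split_ifs <;> simp_all

theorem isStronglyBicartesian_squareCube (x y : P) : (squareCube x y).IsStronglyBicartesian := by
  intro S T _ hcard
  obtain ⟨rfl, rfl⟩ : S = ∅ ∧ T = Finset.univ := by
    revert S T
    decide
  refine ⟨⟨⟨fun s => homOfLE ?_, fun _ _ => Subsingleton.elim _ _,
    fun _ _ _ => Subsingleton.elim _ _⟩⟩, ⟨⟨fun s => homOfLE ?_, fun _ _ => Subsingleton.elim _ _,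
    fun _ _ _ => Subsingleton.elim _ _⟩⟩⟩
  · have hx : s.pt ≤ x := (leOfHom (s.π.app ⟨{0}, by decide⟩) :)
    have hy : s.pt ≤ y := (leOfHom (s.π.app ⟨{1}, by decide⟩) :)
    exact le_inf hx hy
  · have hx : x ≤ s.pt := (leOfHom (s.ι.app ⟨{0}, by decide⟩) :)
    have hy : y ≤ s.pt := (leOfHom (s.ι.app ⟨{1}, by decide⟩) :)
    exact sup_le hx hy

variable {C : Type u} [Category.{v} C] {F : P ⥤ C}

theorem IsCodegree.isPushout (hF : IsCodegree 1 F) (x y : P) :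
    IsPushout (F.map (homOfLE (inf_le_left : x ⊓ y ≤ x))) (F.map (homOfLE (inf_le_right : _ ≤ y)))
      (F.map (homOfLE le_sup_left)) (F.map (homOfLE le_sup_right)) :=
  (hF _ (isStronglyBicartesian_squareCube x y)).isPushout

theorem IsDegree.isPullback (hF : IsDegree 1 F) (x y : P) :
    IsPullback (F.map (homOfLE (inf_le_left : x ⊓ y ≤ x))) (F.map (homOfLE (inf_le_right : _ ≤ y)))
      (F.map (homOfLE le_sup_left)) (F.map (homOfLE le_sup_right)) :=
  (hF _ (isStronglyBicartesian_squareCube x y)).isPullback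

end Square

section Elements

variable {𝕜 : Type u} [Field 𝕜] {P : Type w} [DistribLattice P] {F : PersistenceModule 𝕜 P}

theorem IsDegree.existsUnique_tr_eq (hF : IsDegree 1 F) {p x y q : P} (hp : x ⊓ y = p)
    (hq : x ⊔ y = q) {u : F.stalk x} {v : F.stalk y}
    (huv : F.tr (hq ▸ le_sup_left) u = F.tr (hq ▸ le_sup_right) v) :
    ∃! w : F.stalk p, F.tr (hp ▸ inf_le_left) w = u ∧ F.tr (hp ▸ inf_le_right) w = v := by
  subst hp hq
  have hsq := (hF.isPullback x y).map (forget (ModuleCat 𝕜))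
  obtain ⟨w, hwu, hwv⟩ := Types.exists_of_isPullback hsq u v huv
  exact ⟨w, ⟨hwu, hwv⟩, fun w' hw' => Types.ext_of_isPullback hsq (hw'.1.trans hwu.symm)
    (hw'.2.trans hwv.symm)⟩

theorem IsCodegree.existsUnique_comp_tr_eq (hF : IsCodegree 1 F) {p x y q : P} (hp : x ⊓ y = p)
    (hq : x ⊔ y = q) {φ : Module.Dual 𝕜 (F.stalk x)} {ψ : Module.Dual 𝕜 (F.stalk y)}
    (hφψ : φ ∘ₗ F.tr (hp ▸ inf_le_left) = ψ ∘ₗ F.tr (hp ▸ inf_le_right)) :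
    ∃! χ : Module.Dual 𝕜 (F.stalk q),
      χ ∘ₗ F.tr (hq ▸ le_sup_left) = φ ∧ χ ∘ₗ F.tr (hq ▸ le_sup_right) = ψ := by
  subst hp hq
  have hsq := hF.isPushout x y
  obtain ⟨χ, hχφ, hχψ⟩ := hsq.exists_desc (ModuleCat.ofHom φ) (ModuleCat.ofHom ψ)
    (ModuleCat.hom_ext hφψ)
  refine ⟨χ.hom, ⟨congrArg ModuleCat.Hom.hom hχφ, congrArg ModuleCat.Hom.hom hχψ⟩,
    fun χ' hχ' => congrArg ModuleCat.Hom.hom (hsq.hom_ext (k := ModuleCat.ofHom χ') ?_ ?_)⟩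
  · exact (ModuleCat.hom_ext hχ'.1).trans hχφ.symm
  · exact (ModuleCat.hom_ext hχ'.2).trans hχψ.symm

variable {α β : Type w} [LinearOrder α] [LinearOrder β] {M : PersistenceModule 𝕜 (α × β)}

theorem IsDegree.isTopCartesian [OrderTop α] [OrderTop β] (hM : IsDegree 1 M) :
    M.IsTopCartesian := fun a b _ _ huv =>
  hM.existsUnique_tr_eq (Prod.ext (inf_top_eq a) (top_inf_eq b))
    (Prod.ext (sup_top_eq a) (top_sup_eq b)) huv

theorem IsCodegree.isTopCartesian_prodDual [OrderBot α] [OrderBot β] (hM : IsCodegree 1 M) :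
    M.prodDual.IsTopCartesian := fun a b _ _ huv =>
  hM.existsUnique_comp_tr_eq (Prod.ext (sup_top_eq a) (top_sup_eq b))
    (Prod.ext (inf_top_eq a) (top_inf_eq b)) huv

end Elements

end Cubes

section Decomposition

namespace PersistenceModule

variable {𝕜 : Type u} [Field 𝕜] {P : Type w} [PartialOrder P] {M N : PersistenceModule 𝕜 P}
  {ι : Type*}

/-- The sum of a family of morphisms of persistence modules only finitely many of which are nonzero
at each point. -/
noncomputable def locallyFiniteSum (η : ι → (M ⟶ N)) (hη : ∀ x, {i | appLin (η i) x ≠ 0}.Finite) :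
    M ⟶ N where
  app x := ModuleCat.ofHom (∑ᶠ i, appLin (η i) x)
  naturality x y h := ModuleCat.hom_ext <| by
    have hcomm (i : ι) : appLin (η i) y ∘ₗ M.tr (leOfHom h) = N.tr (leOfHom h) ∘ₗ appLin (η i) x :=
      LinearMap.ext fun v => appLin_tr (η i) (leOfHom h) v
    calc (∑ᶠ i, appLin (η i) y) ∘ₗ M.tr (leOfHom h)
        = ∑ᶠ i, appLin (η i) y ∘ₗ M.tr (leOfHom h) :=
          (LinearMap.lcomp 𝕜 _ (M.tr (leOfHom h))).toAddMonoidHom.map_finsum (hη y)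
      _ = ∑ᶠ i, N.tr (leOfHom h) ∘ₗ appLin (η i) x := finsum_congr hcomm
      _ = N.tr (leOfHom h) ∘ₗ ∑ᶠ i, appLin (η i) x :=
          ((LinearMap.llcomp 𝕜 _ _ _ (N.tr (leOfHom h))).toAddMonoidHom.map_finsum (hη x)).symm

theorem locallyFiniteSum_eq_single (η : ι → (M ⟶ N)) (hη : ∀ x, {i | appLin (η i) x ≠ 0}.Finite)
    {j : ι} (hj : ∀ i ≠ j, η i = 0) : locallyFiniteSum η hη = η j :=
  NatTrans.ext <| funext fun x => ModuleCat.hom_ext <|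
    finsum_eq_single _ j fun i hi => congrArg (fun η => appLin η x) (hj i hi)

theorem finite_appLin_comp_left {η : ι → (M ⟶ N)} (hη : ∀ x, {i | appLin (η i) x ≠ 0}.Finite)
    {L : PersistenceModule 𝕜 P} (θ : L ⟶ M) (x : P) : {i | appLin (θ ≫ η i) x ≠ 0}.Finite :=
  (hη x).subset fun _ => mt fun h => (congrArg (· ∘ₗ appLin θ x) h).trans (LinearMap.zero_comp _)

theorem finite_appLin_comp_right {A N : ι → PersistenceModule 𝕜 P} {η : ∀ i, M ⟶ A i}
    (hη : ∀ x, {i | appLin (η i) x ≠ 0}.Finite) (θ : ∀ i, A i ⟶ N i) (x : P) :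
    {i | appLin (η i ≫ θ i) x ≠ 0}.Finite :=
  (hη x).subset fun i => mt fun h =>
    (congrArg (appLin (θ i) x ∘ₗ ·) h).trans (LinearMap.comp_zero _)

theorem comp_locallyFiniteSum (η : ι → (M ⟶ N)) (hη : ∀ x, {i | appLin (η i) x ≠ 0}.Finite)
    {L : PersistenceModule 𝕜 P} (θ : L ⟶ M) :
    θ ≫ locallyFiniteSum η hη =
      locallyFiniteSum (fun i => θ ≫ η i) (finite_appLin_comp_left hη θ) :=
  NatTrans.ext <| funext fun x => ModuleCat.hom_ext <|
    (LinearMap.lcomp 𝕜 _ (appLin θ x)).toAddMonoidHom.map_finsum (hη x)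

theorem locallyFiniteSum_comp (η : ι → (M ⟶ N)) (hη : ∀ x, {i | appLin (η i) x ≠ 0}.Finite)
    {L : PersistenceModule 𝕜 P} (θ : N ⟶ L) :
    locallyFiniteSum η hη ≫ θ =
      locallyFiniteSum (fun i => η i ≫ θ) (finite_appLin_comp_right hη fun _ => θ) :=
  NatTrans.ext <| funext fun x => ModuleCat.hom_ext <|
    (LinearMap.llcomp 𝕜 _ _ _ (appLin θ x)).toAddMonoidHom.map_finsum (hη x)

section OrthogonalRetracts

variable {A : ι → PersistenceModule 𝕜 P} (ρ : ∀ i, Retract (A i) M)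
  (hfin : ∀ x, {i | appLin (ρ i).r x ≠ 0}.Finite)

/-- The projection of a persistence module onto the sum of a locally finite family of pairwise
orthogonal direct summands. -/
noncomputable def retractSum : M ⟶ M :=
  locallyFiniteSum (fun i => (ρ i).r ≫ (ρ i).i) (finite_appLin_comp_right hfin fun i => (ρ i).i)

variable {ρ} (horth : Pairwise fun i j => (ρ i).i ≫ (ρ j).r = 0)

include horth

theorem i_comp_locallyFiniteSum_r_comp (θ : ∀ i, A i ⟶ N) (j : ι) :
    (ρ j).i ≫ locallyFiniteSum (fun i => (ρ i).r ≫ θ i) (finite_appLin_comp_right hfin θ) =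
      θ j := by
  rw [comp_locallyFiniteSum, locallyFiniteSum_eq_single _ _ (j := j), Retract.retract_assoc]
  intro i hi
  rw [← Category.assoc, horth hi.symm, zero_comp]

theorem i_comp_retractSum (j : ι) : (ρ j).i ≫ retractSum ρ hfin = (ρ j).i :=
  i_comp_locallyFiniteSum_r_comp hfin horth (fun i => (ρ i).i) j

theorem retractSum_comp_r (j : ι) : retractSum ρ hfin ≫ (ρ j).r = (ρ j).r := by
  rw [retractSum, locallyFiniteSum_comp, locallyFiniteSum_eq_single _ _ (j := j), Category.assoc,
    Retract.retract, Category.comp_id]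
  intro i hi
  rw [Category.assoc, horth hi, comp_zero]

theorem retractSum_comp_retractSum :
    retractSum ρ hfin ≫ retractSum ρ hfin = retractSum ρ hfin := by
  refine (locallyFiniteSum_comp _ _ _).trans ?_
  simp only [Category.assoc, i_comp_retractSum hfin horth]
  rfl

theorem nonempty_isColimit_cofan_of_retractSum_eq_id (h : retractSum ρ hfin = 𝟙 M) :
    Nonempty (IsColimit (Cofan.mk M fun i => (ρ i).i)) := by
  refine ⟨Cofan.IsColimit.mk _
    (fun c => locallyFiniteSum (fun i => (ρ i).r ≫ c.inj i) (finite_appLin_comp_right hfin c.inj))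
    (fun c j => i_comp_locallyFiniteSum_r_comp hfin horth c.inj j) fun c m hm => ?_⟩
  have hc : c.inj = fun i => (ρ i).i ≫ m := funext fun i => (hm i).symm
  calc m = retractSum ρ hfin ≫ m := by rw [h, Category.id_comp]
    _ = locallyFiniteSum (fun i => (ρ i).r ≫ c.inj i) (finite_appLin_comp_right hfin c.inj) := by
      simp only [retractSum, locallyFiniteSum_comp, Category.assoc, hc]

include hfin

theorem exists_complement_of_orthogonal_retracts :
    ∃ (C : PersistenceModule 𝕜 P) (σ : Retract C M),
      (∀ i, (ρ i).i ≫ σ.r = 0) ∧ (∀ i, σ.i ≫ (ρ i).r = 0) ∧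
      ((∀ x, Subsingleton (C.stalk x)) →
        Nonempty (IsColimit (Cofan.mk M fun i => (ρ i).i))) := by
  have hidem : (𝟙 M - retractSum ρ hfin) ≫ (𝟙 M - retractSum ρ hfin) =
      𝟙 M - retractSum ρ hfin := by
    simp [retractSum_comp_retractSum hfin horth]
  obtain ⟨C, i, r, hir, hri⟩ := IsIdempotentComplete.idempotents_split M _ hidem
  refine ⟨C, ⟨i, r, hir⟩, fun j => ?_, fun j => ?_, fun hC => ?_⟩
  · calc (ρ j).i ≫ r = ((ρ j).i ≫ (𝟙 M - retractSum ρ hfin)) ≫ r := by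
          rw [← hri, Category.assoc, Category.assoc, hir, Category.comp_id]
      _ = 0 := by
          rw [Preadditive.comp_sub, Category.comp_id, i_comp_retractSum hfin horth, sub_self,
            zero_comp]
  · calc i ≫ (ρ j).r = i ≫ (𝟙 M - retractSum ρ hfin) ≫ (ρ j).r := by
          rw [← hri, Category.assoc, reassoc_of% hir]
      _ = 0 := by
          rw [Preadditive.sub_comp, Category.id_comp, retractSum_comp_r hfin horth, sub_self,
            comp_zero]
  · refine nonempty_isColimit_cofan_of_retractSum_eq_id hfin horth ?_
    have hr : r = 0 := NatTrans.ext <| funext fun x => ModuleCat.hom_ext <|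
      LinearMap.ext fun v => (hC x).elim _ _
    rw [hr, zero_comp, eq_comm, sub_eq_zero] at hri
    exact hri.symm

end OrthogonalRetracts

end PersistenceModule

section IntervalModule

variable {𝕜 : Type u} [Field 𝕜] {P : Type w} {I : Set P} {x y : P}

theorem coe_eq_zero_of_notMem (hx : x ∉ I) (c : intervalStalk 𝕜 I x) : (c : 𝕜) = 0 := by
  simpa [intervalStalk, hx] using c.2

theorem coe_intervalMap (hx : x ∈ I) (hy : y ∈ I) (c : intervalStalk 𝕜 I x) :
    (intervalMap 𝕜 I x y c : 𝕜) = c := by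
  simp [intervalMap, hx, hy]

end IntervalModule

namespace IntervalSummand

open PersistenceModule

variable {𝕜 : Type u} [Field 𝕜] {P : Type w} [PartialOrder P] {M : PersistenceModule 𝕜 P}

theorem coord_mem_intervalStalk (s : IntervalSummand M) {x : P} (v : M.stalk x) :
    s.coord x v ∈ intervalStalk 𝕜 s.support x := by
  by_cases hx : x ∈ s.support <;> simp [intervalStalk, hx, s.coord_of_notMem]

/-- The inclusion of the interval module over the support of an interval summand, mapping `1` to the
generator. -/
noncomputable def incl (s : IntervalSummand M) (hs : IsPosetInterval s.support) :
    intervalModule 𝕜 s.support hs ⟶ M where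
  app x := ModuleCat.ofHom
    (LinearMap.toSpanSingleton 𝕜 (M.stalk x) (s.gen x) ∘ₗ (intervalStalk 𝕜 s.support x).subtype)
  naturality x y h := ModuleCat.hom_ext <|
    LinearMap.ext fun (c : intervalStalk 𝕜 s.support x) => by
      change (intervalMap 𝕜 s.support x y c : 𝕜) • s.gen y = M.tr (leOfHom h) ((c : 𝕜) • s.gen x)
      rw [map_smul]
      by_cases hx : x ∈ s.support
      · rw [s.tr_gen _ hx]
        by_cases hy : y ∈ s.support
        · rw [coe_intervalMap hx hy]
        · rw [s.gen_of_notMem hy, smul_zero, smul_zero]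
      · simp [intervalMap, hx, coe_eq_zero_of_notMem hx]

/-- The projection of a persistence module onto the interval module over the support of an interval
summand, given by the coordinate. -/
noncomputable def proj (s : IntervalSummand M) (hs : IsPosetInterval s.support) :
    M ⟶ intervalModule 𝕜 s.support hs where
  app x := ModuleCat.ofHom
    ((s.coord x).codRestrict (intervalStalk 𝕜 s.support x) s.coord_mem_intervalStalk)
  naturality x y h := ModuleCat.hom_ext <| LinearMap.ext fun v => Subtype.ext <| by
    change s.coord y (M.tr (leOfHom h) v) =
      (intervalMap 𝕜 s.support x y ⟨s.coord x v, s.coord_mem_intervalStalk v⟩ : 𝕜)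
    by_cases hy : y ∈ s.support
    · rw [s.coord_tr _ hy]
      by_cases hx : x ∈ s.support
      · rw [coe_intervalMap hx hy]
      · simp [intervalMap, hx, s.coord_of_notMem hx]
    · rw [coe_eq_zero_of_notMem hy, s.coord_of_notMem hy, LinearMap.zero_apply]

/-- The interval module over the support of an interval summand, as a direct summand. -/
@[simps]
noncomputable def retract (s : IntervalSummand M) (hs : IsPosetInterval s.support) :
    Retract (intervalModule 𝕜 s.support hs) M where
  i := s.incl hs
  r := s.proj hs
  retract := NatTrans.ext <| funext fun x => ModuleCat.hom_ext <|
    LinearMap.ext fun (c : intervalStalk 𝕜 s.support x) => Subtype.ext <| by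
      change s.coord x ((c : 𝕜) • s.gen x) = c
      by_cases hx : x ∈ s.support
      · rw [map_smul, s.coord_gen hx, smul_eq_mul, mul_one]
      · rw [coe_eq_zero_of_notMem hx, zero_smul, map_zero]

theorem exists_appLin_incl_eq_gen (s : IntervalSummand M) (hs : IsPosetInterval s.support)
    (x : P) : ∃ c, appLin (s.incl hs) x c = s.gen x := by
  by_cases hx : x ∈ s.support
  · exact ⟨(⟨1, by simp [intervalStalk, hx]⟩ : intervalStalk 𝕜 s.support x),
      one_smul 𝕜 (s.gen x)⟩
  · exact ⟨0, (map_zero _).trans (s.gen_of_notMem hx).symm⟩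

/-- The projection onto the interval summand `s` vanishes on the interval summand `t`. -/
def Orthogonal (s t : IntervalSummand M) : Prop :=
  ∀ x, s.coord x (t.gen x) = 0

theorem not_orthogonal_self (s : IntervalSummand M) (hs : s.support.Nonempty) :
    ¬ s.Orthogonal s := fun h =>
  hs.elim fun x hx => one_ne_zero ((s.coord_gen hx).symm.trans (h x))

section Family

variable {ι : Type*} {s : ι → IntervalSummand M}
  (horth : Pairwise fun i j => (s i).Orthogonal (s j))

include horth

theorem finite_setOf_mem_support (hM : M.IsPFD) (x : P) : {i | x ∈ (s i).support}.Finite := by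
  have : FiniteDimensional 𝕜 (M.stalk x) := hM x
  have hindep : LinearIndependent 𝕜 fun i : {i | x ∈ (s i).support} => (s i).gen x :=
    .of_pairwise_dual_eq_zero_one _ (fun i => (s i).coord x)
      (fun i j hij => horth (Subtype.coe_injective.ne hij) x) fun i => (s i).coord_gen i.2
  exact Set.finite_coe_iff.1 hindep.finite

theorem small_of_pairwise_orthogonal (hM : M.IsPFD) (hs : ∀ i, (s i).support.Nonempty) :
    Small.{w} ι := by
  have (x : P) : Small.{w} {i | x ∈ (s i).support} := by
    have := (finite_setOf_mem_support horth hM x).to_subtype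
    infer_instance
  have hcover : ⋃ x, {i | x ∈ (s i).support} = Set.univ :=
    Set.eq_univ_of_forall fun i => Set.mem_iUnion.2 (hs i)
  rw [← small_univ_iff, ← hcover]
  infer_instance

theorem incl_comp_proj (hs : ∀ i, IsPosetInterval (s i).support) :
    Pairwise fun i j => (s i).incl (hs i) ≫ (s j).proj (hs j) = 0 := fun i j hij =>
  NatTrans.ext <| funext fun x => ModuleCat.hom_ext <|
    LinearMap.ext fun (c : intervalStalk 𝕜 (s i).support x) => Subtype.ext <| by
      change (s j).coord x (c.1 • (s i).gen x) = 0
      rw [map_smul, horth hij.symm x, smul_zero]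

theorem exists_complement_of_pairwise_orthogonal (hM : M.IsPFD)
    (hs : ∀ i, IsPosetInterval (s i).support) :
    ∃ (C : PersistenceModule 𝕜 P) (σ : Retract C M),
      (∀ t i, (s i).Orthogonal (ofRetract σ t)) ∧ (∀ t i, (ofRetract σ t).Orthogonal (s i)) ∧
      ((∀ x, Subsingleton (C.stalk x)) →
        Nonempty (IsColimit (Cofan.mk M fun i => ((s i).retract (hs i)).i))) := by
  have hfin (x : P) : {i | appLin ((s i).retract (hs i)).r x ≠ 0}.Finite :=
    (finite_setOf_mem_support horth hM x).subset fun i => not_imp_comm.1 fun hx =>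
      LinearMap.ext fun v => Subtype.ext (LinearMap.congr_fun ((s i).coord_of_notMem hx) v)
  obtain ⟨C, σ, hr, hi, hcolim⟩ := exists_complement_of_orthogonal_retracts hfin
    (incl_comp_proj horth hs)
  refine ⟨C, σ, fun t i x => ?_, fun t i x => ?_, hcolim⟩
  · exact congrArg (fun η => (appLin η x (t.gen x) : intervalStalk 𝕜 (s i).support x).1) (hi i)
  · obtain ⟨c, hc⟩ := (s i).exists_appLin_incl_eq_gen (hs i) x
    rw [ofRetract_coord, LinearMap.comp_apply, ← hc]
    exact (congrArg (fun η => t.coord x (appLin η x c)) (hr i)).trans (map_zero _)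

end Family

end IntervalSummand

theorem PersistenceModule.isIntervalDecomposableOver_of_exists_intervalSummand {𝕜 : Type u}
    [Field 𝕜] {P : Type w} [PartialOrder P] {M : PersistenceModule 𝕜 P} (hM : M.IsPFD)
    {B : Set P → Prop} (hB : ∀ I, B I → IsPosetInterval I)
    (hex : ∀ (C : PersistenceModule 𝕜 P) (_ : Retract C M) (x : P) [Nontrivial (C.stalk x)],
      ∃ s : IntervalSummand C, B s.support) :
    M.IsIntervalDecomposableOver B := by
  obtain ⟨S, hS⟩ := zorn_subset
    {S : Set (IntervalSummand M) | (∀ s ∈ S, B s.support) ∧ S.Pairwise IntervalSummand.Orthogonal}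
    fun c hc hchain => ⟨⋃₀ c,
      ⟨fun s ⟨T, hT, hs⟩ => (hc hT).1 s hs,
        (Set.pairwise_sUnion hchain.directedOn).2 fun T hT => (hc hT).2⟩,
      fun T => Set.subset_sUnion_of_mem⟩
  have hSB (s : S) : IsPosetInterval s.1.support := hB _ (hS.prop.1 s s.2)
  have horth : Pairwise fun s t : S => s.1.Orthogonal t.1 := fun s t hst =>
    hS.prop.2 s.2 t.2 (Subtype.coe_injective.ne hst)
  have : Small.{w} S :=
    IntervalSummand.small_of_pairwise_orthogonal horth hM fun s => (hSB s).nonempty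
  let e := (equivShrink.{w} S).symm
  obtain ⟨C, σ, hleft, hright, hcolim⟩ :=
    IntervalSummand.exists_complement_of_pairwise_orthogonal (s := fun i => (e i).1)
      (fun i j hij => horth (e.injective.ne hij)) hM fun i => hSB (e i)
  refine ⟨Shrink.{w} S, fun i => (e i).1.support, fun i => hSB (e i), Cofan.mk M _,
    fun i => hS.prop.1 _ (e i).2, hcolim fun x => ?_, ⟨Iso.refl M⟩⟩
  by_contra hx
  have := not_subsingleton_iff_nontrivial.1 hx
  obtain ⟨t, ht⟩ := hex C σ x
  have hmem : t.ofRetract σ ∈ S := by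
    refine hS.mem_of_prop_insert ⟨Set.forall_mem_insert.2 ⟨ht, hS.prop.1⟩, ?_⟩
    refine hS.prop.2.insert fun s hs _ => ?_
    obtain ⟨i, hi⟩ := e.surjective ⟨s, hs⟩
    have hi : (e i).1 = s := congrArg Subtype.val hi
    exact ⟨hi ▸ hright t i, hi ▸ hleft t i⟩
  obtain ⟨i, hi⟩ := e.surjective ⟨_, hmem⟩
  refine (t.ofRetract σ).not_orthogonal_self (hB _ ht).nonempty ?_
  have := hright t i
  rwa [hi] at this

end Decomposition

theorem mainTheorem2_general {𝕜 : Type u} [Field 𝕜] {α β : Type w} [LinearOrder α] [LinearOrder β]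
    (F : PersistenceModule 𝕜 (α × β)) (hF : F.IsPFD) :
    (∀ [OrderBot α] [OrderBot β], IsCodegree 1 F → F.IsIntervalDecomposableOver
      (fun I => IsLowerBlock I ∨ IsVerticalStrip I ∨ IsHorizontalStrip I)) ∧
    (∀ [OrderTop α] [OrderTop β], IsDegree 1 F → F.IsIntervalDecomposableOver
      (fun I => IsUpperBlock I ∨ IsVerticalStrip I ∨ IsHorizontalStrip I)) := by
  refine ⟨fun hcodeg => ?_, fun hdeg => ?_⟩ <;>
    refine PersistenceModule.isIntervalDecomposableOver_of_exists_intervalSummand hF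
      (fun I hI => hI.elim And.left (·.elim And.left And.left)) fun C ρ x _ => ?_
  · let ρ' : Retract C.prodDual F.prodDual :=
      PersistenceModule.retractComap (PersistenceModule.retractDual ρ) (toDualProd α β)
    exact C.exists_intervalSummand_of_isTopCartesian_prodDual
      (hcodeg.isTopCartesian_prodDual.of_retract ρ') (.of_retract ρ hF) (p := x)
  · exact (hdeg.isTopCartesian.of_retract ρ).exists_intervalSummand (.of_retract ρ hF) (p := x)

theorem mainTheorem2 (𝕜 : Type u) [Field 𝕜] (F : PersistenceModule 𝕜 (ℝ≥0∞ × ℝ≥0∞))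
    (hF : F.IsPFD) :
    (IsCodegree 1 F → F.IsIntervalDecomposableOver
      (fun I => IsDeathBlock I ∨ IsVerticalBlock I ∨ IsHorizontalBlock I)) ∧
    (IsDegree 1 F → F.IsIntervalDecomposableOver
      (fun I => IsBirthBlock I ∨ IsVerticalBlock I ∨ IsHorizontalBlock I)) :=
  ⟨(mainTheorem2_general F hF).1, (mainTheorem2_general F hF).2⟩
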